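/- Let $n\ge 2$ and let $s,p,K:\mathbb R^n\times\mathbb R^n\to\mathbb R$ be measurable and symmetric ($f(x,y)=f(y,x)$ for all $x,y$), with $$0<s^-:=\inf s\le s^+:=\sup s<1,\qquad 1<p^-:=\inf p\le p^+:=\sup p<\infty,$$ (infima and suprema over $\mathbb R^n\times\mathbb R^n$) and, for some $\Lambda>1$, $$\frac{\Lambda^{-1}}{|x-y|^{n+s(x,y)p(x,y)}}\le K(x,y)\le\frac{\Lambda}{|x-y|^{n+s(x,y)p(x,y)}}\quad\text{for a.e. }(x,y)\in\mathbb R^n\times\mathbb R^n.$$ Let $\Omega\subset\mathbb R^n$ be a bounded open set with Lipschitz boundary, put $\mathcal C_\Omega:=(\mathbb R^n\times\mathbb R^n)\setminus((\mathbb R^n\setminus\Omega)\times(\mathbb R^n\setminus\Omega))$ and $p^-_\Omega:=\inf_{\Omega\times\Omega}p$. Let $\mathbb W^{s(\cdot,\cdot),p(\cdot,\cdot)}(\Omega)$ be the set of measurable $v:\mathbb R^n\to\mathbb R$ with $$v|_\Omega\in L^{p^-_\Omega}(\Omega)\quad\text{and}\quad\iint_{\mathcal C_\Omega}\frac{|v(x)-v(y)|^{p(x,y)}}{|x-y|^{n+s(x,y)p(x,y)}}\,dy\,dx<\infty,$$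 and let the tail space $L^\infty(\Omega;L^{p(\cdot,\cdot)-1}_{s(\cdot,\cdot)p(\cdot,\cdot)}(\mathbb R^n))$ be the set of measurable $v:\mathbb R^n\to\mathbb R$ with $$\operatorname*{ess\,sup}_{x\in\Omega}\int_{\mathbb R^n}\frac{|v(y)|^{p(x,y)-1}}{(1+|y|)^{n+s(x,y)p(x,y)}}\,dy<\infty.$$ A function $u\in\mathbb W^{s(\cdot,\cdot),p(\cdot,\cdot)}(\Omega)$ is called a minimizer of $$\mathcal E(v;\Omega):=\iint_{\mathcal C_\Omega}\frac1{p(x,y)}|v(x)-v(y)|^{p(x,y)}K(x,y)\,dy\,dx$$ if $\mathcal E(u;\Omega)\le\mathcal E(v;\Omega)$ for every $v\in\mathbb W^{s(\cdot,\cdot),p(\cdot,\cdot)}(\Omega)$ with $v=u$ a.e. in $\mathbb R^n\setminus\Omega$. Let $g\in\mathbb W^{s(\cdot,\cdot),p(\cdot,\cdot)}(\Omega)$. Then there exists a minimizer $u\in\mathbb W^{s(\cdot,\cdot),p(\cdot,\cdot)}(\Omega)$ of $\mathcal E(\cdot\,;\Omega)$ with $u=g$ a.e. in $\mathbb R^n\setminus\Omega$,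 and it is unique up to equality a.e. in $\mathbb R^n$. Moreover, suppose that either $s^-p^-<n$ and $p^+-1<\frac{np^-}{n-s^-p^-}$, or $s^-p^-\ge n$. If in addition $g\in L^\infty(\Omega;L^{p(\cdot,\cdot)-1}_{s(\cdot,\cdot)p(\cdot,\cdot)}(\mathbb R^n))$, then the minimizer $u$ also belongs to $L^\infty(\Omega;L^{p(\cdot,\cdot)-1}_{s(\cdot,\cdot)p(\cdot,\cdot)}(\mathbb R^n))$. -/

import Mathlib

open MeasureTheory
open scoped ENNReal NNReal

noncomputable section

/-- Euclidean space `ℝⁿ`. -/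
abbrev Rn (n : ℕ) : Type := EuclideanSpace ℝ (Fin n)

/-- `f^-_E`, the infimum of `f` over `E × E`. -/
def infOn {n : ℕ} (f : Rn n × Rn n → ℝ) (E : Set (Rn n)) : ℝ := sInf (f '' (E ×ˢ E))

/-- `f^+_E`, the supremum of `f` over `E × E`. -/
def supOn {n : ℕ} (f : Rn n × Rn n → ℝ) (E : Set (Rn n)) : ℝ := sSup (f '' (E ×ˢ E))

/-- `f(x,y) = f(y,x)` for all `x, y`. -/
def IsSymm2 {n : ℕ} (f : Rn n × Rn n → ℝ) : Prop := ∀ x y, f (x, y) = f (y, x)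

/-- A set with Lipschitz boundary: near every boundary point, in suitable orthonormal
coordinates `(x', x_n)`, the set is the part lying strictly above the graph of a Lipschitz
function of `x'`. -/
def HasLipschitzBoundary {n : ℕ} (Ω : Set (Rn n)) : Prop :=
  ∀ x₀ ∈ frontier Ω, ∃ r : ℝ, 0 < r ∧
    ∃ (e : Rn n ≃ₗᵢ[ℝ] WithLp 2 (Rn (n - 1) × ℝ)) (L : ℝ≥0) (γ : Rn (n - 1) → ℝ),
      LipschitzWith L γ ∧
      Ω ∩ Metric.ball x₀ r = {x | x ∈ Metric.ball x₀ r ∧ γ (e x).fst < (e x).snd}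

/-- `C_Ω = (ℝⁿ × ℝⁿ) \ ((ℝⁿ \ Ω) × (ℝⁿ \ Ω))`. -/
def crossSet {n : ℕ} (Ω : Set (Rn n)) : Set (Rn n × Rn n) := (Ωᶜ ×ˢ Ωᶜ)ᶜ

/-- `∬_{C_Ω} |v(x)-v(y)|^{p(x,y)} / |x-y|^{n+s(x,y)p(x,y)} dy dx`, with values in `[0,∞]`. -/
def gagliardoModular {n : ℕ} (s p : Rn n × Rn n → ℝ) (Ω : Set (Rn n)) (v : Rn n → ℝ) : ℝ≥0∞ :=
  ∫⁻ z in crossSet Ω,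
    ENNReal.ofReal (|v z.1 - v z.2| ^ p z / ‖z.1 - z.2‖ ^ ((n : ℝ) + s z * p z))

/-- Membership in `𝕎^{s(·,·),p(·,·)}(Ω)`. Measurability is Lebesgue measurability. -/
structure MemW {n : ℕ} (s p : Rn n × Rn n → ℝ) (Ω : Set (Rn n)) (v : Rn n → ℝ) : Prop where
  aemeasurable : AEMeasurable v volume
  memLp : MemLp v (ENNReal.ofReal (infOn p Ω)) (volume.restrict Ω)
  modular_lt_top : gagliardoModular s p Ω v < ∞

/-- Membership in the tail space `L^∞(Ω; L^{p(·,·)-1}_{s(·,·)p(·,·)}(ℝⁿ))`. -/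
structure MemTail {n : ℕ} (s p : Rn n × Rn n → ℝ) (Ω : Set (Rn n)) (v : Rn n → ℝ) : Prop where
  aemeasurable : AEMeasurable v volume
  essSup_lt_top :
    essSup (fun x => ∫⁻ y, ENNReal.ofReal
      (|v y| ^ (p (x, y) - 1) / (1 + ‖y‖) ^ ((n : ℝ) + s (x, y) * p (x, y))))
      (volume.restrict Ω) < ∞

/-- The energy `∬_{C_Ω} (1/p(x,y)) |v(x)-v(y)|^{p(x,y)} K(x,y) dy dx`, with values in `[0,∞]`. -/
def energy {n : ℕ} (p K : Rn n × Rn n → ℝ) (Ω : Set (Rn n)) (v : Rn n → ℝ) : ℝ≥0∞ :=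
  ∫⁻ z in crossSet Ω, ENNReal.ofReal (1 / p z * |v z.1 - v z.2| ^ p z * K z)

/-- `u ∈ 𝕎(Ω)` minimizes the energy among all `v ∈ 𝕎(Ω)` with `v = u` a.e. outside `Ω`. -/
def IsMinimizer {n : ℕ} (s p K : Rn n × Rn n → ℝ) (Ω : Set (Rn n)) (u : Rn n → ℝ) : Prop :=
  MemW s p Ω u ∧
    ∀ v : Rn n → ℝ, MemW s p Ω v → u =ᵐ[volume.restrict Ωᶜ] v → energy p K Ω u ≤ energy p K Ω v

end

/-! Existence and uniqueness follow from uniform convexity rather than weak compactness. The powers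
|·|^q are uniformly convex, uniformly for q in a compact subinterval of (1, ∞), and integration
passes this to the energy. If two competitors almost attain the infimum, their midpoint, again a
competitor, cannot go below it, so their difference has small energy (`exists_energy_sub_le`). That
difference vanishes outside Ω; comparing its values in Ω with its zero values on a ball away from Ω
bounds its L¹ norm (`exists_lintegral_enorm_le`). A minimizing sequence thus has an a.e. convergent
subsequence, and Fatou's lemma makes the limit a minimizer. The same estimate applied to two
minimizers gives uniqueness.

For the tail, u = g outside Ω, so it suffices that |u|^(p⁺-1) is integrable on Ω. A Lipschitz domain
has positive measure density, so near a point where |u| > 2t a fixed share of a suitable ball lies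
in Ω ∩ {|u| ≤ t}. The finite modular then yields m(2t) ≤ C t^(-p⁻) m(t)^θ with m(t) = |Ω ∩ {|u| >
t}| and θ = s⁻p⁻/n (`exists_levelSet_le`). Iteration gives decay of order p⁻(1 + θ + ... + θ^(j-1)).
These exponents tend to np⁻/(n - s⁻p⁻) if θ < 1 and to infinity otherwise, so some j exceeds p⁺ - 1,
and the layer cake formula concludes. -/

/-! ### Uniform convexity of powers -/

lemma abs_midpoint_rpow_lt {q : ℝ} (hq : 1 < q) {a b : ℝ} (hab : a ≠ b) :
    |(a + b) / 2| ^ q < (|a| ^ q + |b| ^ q) / 2 := by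
  have hq0 : 0 < q := by linarith
  by_cases h : |a| = |b|
  · obtain h' | h' := abs_eq_abs.1 h
    · exact absurd h' hab
    · have hb : b ≠ 0 := by
        rintro rfl
        simp at h'
        exact hab h'
      have : 0 < |b| ^ q := Real.rpow_pos_of_pos (abs_pos.2 hb) _
      rw [h']
      simp only [neg_add_cancel, zero_div, abs_zero, Real.zero_rpow hq0.ne', abs_neg]
      linarith
  · have h1 := (strictConvexOn_rpow hq).2 (abs_nonneg a) (abs_nonneg b) h
      (show (0 : ℝ) < 1 / 2 by norm_num) (show (0 : ℝ) < 1 / 2 by norm_num) (by norm_num)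
    simp only [smul_eq_mul] at h1
    have h2 : |(a + b) / 2| ≤ 1 / 2 * |a| + 1 / 2 * |b| := by
      rw [abs_div, abs_two]
      linarith [abs_add_le a b]
    have h3 := Real.rpow_le_rpow (abs_nonneg _) h2 hq0.le
    linarith

lemma abs_midpoint_rpow_le {q : ℝ} (hq : 1 < q) (a b : ℝ) :
    |(a + b) / 2| ^ q ≤ (|a| ^ q + |b| ^ q) / 2 := by
  by_cases h : a = b
  · subst h
    simp
  · exact (abs_midpoint_rpow_lt hq h).le

/-- Uniform convexity of `|·|^q`, uniformly for `q` in a compact subinterval of `(1, ∞)`. -/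
lemma exists_uniform_convexity_rpow {pm pP : ℝ} (hpm : 1 < pm) {ε : ℝ} (hε : 0 < ε) :
    ∃ C : ℝ, 0 ≤ C ∧ ∀ q ∈ Set.Icc pm pP, ∀ a b : ℝ,
      |a - b| ^ q + C * |(a + b) / 2| ^ q ≤ (ε + C / 2) * (|a| ^ q + |b| ^ q) := by
  have hcont : ∀ f : ℝ × ℝ × ℝ → ℝ, Continuous f →
      ContinuousOn (fun z : ℝ × ℝ × ℝ => |f z| ^ z.1) {z | pm ≤ z.1} := by
    intro f hf
    refine ContinuousOn.rpow hf.abs.continuousOn continuous_fst.continuousOn ?_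
    intro z hz
    exact Or.inr (by have : pm ≤ z.1 := hz; linarith)
  -- By homogeneity it is enough to treat max |a| |b| = 1, where (q, a, b) ranges over a compact
  -- set.
  set D : Set (ℝ × ℝ × ℝ) := Set.Icc pm pP ×ˢ (Set.Icc (-1) 1 ×ˢ Set.Icc (-1) 1) with hD
  have hDc : IsCompact D := isCompact_Icc.prod (isCompact_Icc.prod isCompact_Icc)
  have hDp : D ⊆ {z | pm ≤ z.1} := fun z hz => hz.1.1
  have ca := (hcont (fun z => z.2.1) (by fun_prop)).mono hDp
  have cb := (hcont (fun z => z.2.2) (by fun_prop)).mono hDp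
  have cd := (hcont (fun z => z.2.1 - z.2.2) (by fun_prop)).mono hDp
  have cm := (hcont (fun z => (z.2.1 + z.2.2) / 2) (by fun_prop)).mono hDp
  -- The normalized triples for which the ε-term alone need not control |a - b|^q. There a ≠ b, so
  -- the convexity gap is positive, with a positive minimum δ by compactness.
  set S : Set (ℝ × ℝ × ℝ) := D ∩ {z | 0 ≤ |z.2.1 - z.2.2| ^ z.1 - ε * (|z.2.1| ^ z.1 + |z.2.2| ^ z.1)
    ∧ 1 ≤ max |z.2.1| |z.2.2|} with hS
  have hSc : IsCompact S := by
    have h1 := (cd.sub ((ca.add cb).const_mul ε)).preimage_isClosed_of_isClosed hDc.isClosed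
      (isClosed_Ici (a := (0 : ℝ)))
    have h2 : IsClosed {z : ℝ × ℝ × ℝ | 1 ≤ max |z.2.1| |z.2.2|} :=
      isClosed_le continuous_const (by fun_prop)
    refine (hDc.inter_right (h2)).of_isClosed_subset (?_ : IsClosed S) ?_
    · have := h1.inter h2
      convert this using 1
      ext z
      simp [hS, and_assoc]
    · intro z hz
      exact ⟨hz.1, hz.2.2⟩
  obtain ⟨δ, hδ, hδS⟩ : ∃ δ : ℝ, 0 < δ ∧ ∀ z ∈ S,
      δ ≤ (|z.2.1| ^ z.1 + |z.2.2| ^ z.1) / 2 - |(z.2.1 + z.2.2) / 2| ^ z.1 := by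
    have hc : ContinuousOn (fun z : ℝ × ℝ × ℝ =>
        (|z.2.1| ^ z.1 + |z.2.2| ^ z.1) / 2 - |(z.2.1 + z.2.2) / 2| ^ z.1) S :=
      (((ca.add cb).div_const 2).sub cm).mono Set.inter_subset_left
    rcases S.eq_empty_or_nonempty with h | h
    · exact ⟨1, one_pos, by simp [h]⟩
    · obtain ⟨z, hz, hmin⟩ := hSc.exists_isMinOn h hc
      refine ⟨_, ?_, fun w hw => hmin hw⟩
      have hq : 1 < z.1 := lt_of_lt_of_le hpm hz.1.1.1
      have hne : z.2.1 ≠ z.2.2 := by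
        intro he
        have h0 := hz.2.1
        rw [he, sub_self, abs_zero, Real.zero_rpow (by linarith)] at h0
        have h1 := hz.2.2
        rw [he, max_self] at h1
        have : 0 < |z.2.2| ^ z.1 := Real.rpow_pos_of_pos (by linarith) _
        nlinarith
      linarith [abs_midpoint_rpow_lt hq hne]
  -- In the unit box |a - b|^q ≤ 2^pP, and on S this is at most C times the gap once C δ = 2^pP.
  refine ⟨2 ^ pP / δ, by positivity, ?_⟩
  intro q hq a b
  have hq1 : 1 < q := lt_of_lt_of_le hpm hq.1
  have hunit : ∀ a b : ℝ, max |a| |b| = 1 →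
      |a - b| ^ q + 2 ^ pP / δ * |(a + b) / 2| ^ q
        ≤ (ε + 2 ^ pP / δ / 2) * (|a| ^ q + |b| ^ q) := by
    intro a b hab
    have ha : |a| ≤ 1 := hab ▸ le_max_left _ _
    have hb : |b| ≤ 1 := hab ▸ le_max_right _ _
    have hmid := abs_midpoint_rpow_le hq1 a b
    have hC : 0 ≤ 2 ^ pP / δ := by positivity
    by_cases h : 0 ≤ |a - b| ^ q - ε * (|a| ^ q + |b| ^ q)
    · have hmem : (q, a, b) ∈ S := ⟨⟨hq, abs_le.1 ha, abs_le.1 hb⟩, h, hab.ge⟩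
      have h1 := hδS _ hmem
      simp only at h1
      have h2 : |a - b| ^ q ≤ 2 ^ pP := by
        calc |a - b| ^ q ≤ 2 ^ q := Real.rpow_le_rpow (abs_nonneg _)
              (by linarith [abs_sub a b]) (by linarith)
          _ ≤ 2 ^ pP := Real.rpow_le_rpow_of_exponent_le (by norm_num) hq.2
      have h3 : 2 ^ pP ≤ 2 ^ pP / δ * ((|a| ^ q + |b| ^ q) / 2 - |(a + b) / 2| ^ q) := by
        calc (2 : ℝ) ^ pP = 2 ^ pP / δ * δ := by field_simp
          _ ≤ _ := by gcongr
      have h4 : 0 ≤ ε * (|a| ^ q + |b| ^ q) := by positivity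
      nlinarith
    · push Not at h
      nlinarith
  set t := max |a| |b| with ht
  have ht0 : 0 ≤ t := le_max_of_le_left (abs_nonneg a)
  rcases ht0.eq_or_lt with h0 | h0
  · have ha : a = 0 := abs_nonpos_iff.1 (by rw [h0]; exact le_max_left _ _)
    have hb : b = 0 := abs_nonpos_iff.1 (by rw [h0]; exact le_max_right _ _)
    subst ha hb
    simp [Real.zero_rpow (by linarith : q ≠ 0)]
  · have hm : max |a / t| |b / t| = 1 := by
      rw [abs_div, abs_div, abs_of_pos h0, max_div_div_right h0.le, ← ht, div_self h0.ne']
    have key := hunit _ _ hm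
    have e1 : a / t - b / t = (a - b) / t := by ring
    have e2 : (a / t + b / t) / 2 = ((a + b) / 2) / t := by ring
    have hdiv : ∀ c : ℝ, |c / t| ^ q = |c| ^ q / t ^ q := by
      intro c
      rw [abs_div, abs_of_pos h0, Real.div_rpow (abs_nonneg _) ht0]
    rw [e1, e2, hdiv, hdiv, hdiv, hdiv] at key
    have htq : 0 < t ^ q := Real.rpow_pos_of_pos h0 _
    have := mul_le_mul_of_nonneg_right key htq.le
    field_simp at this ⊢
    linarith

/-! ### Comparison of energy and modular, convexity of the energy -/

/-- Quantitative bounds on the order `s`, the exponent `p` and the kernel `K`. -/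
structure KernelBounds {n : ℕ} (s p K : Rn n × Rn n → ℝ) (σ pm pP Λ : ℝ) : Prop where
  s_meas : AEMeasurable s volume
  p_meas : AEMeasurable p volume
  K_meas : AEMeasurable K volume
  σ_pos : 0 < σ
  le_s : ∀ z, σ ≤ s z
  s_le : ∀ z, s z ≤ 1
  one_lt : 1 < pm
  le_p : ∀ z, pm ≤ p z
  p_le : ∀ z, p z ≤ pP
  Λ_pos : 0 < Λ
  bounds : ∀ᵐ z : Rn n × Rn n,
      Λ⁻¹ / ‖z.1 - z.2‖ ^ ((n : ℝ) + s z * p z) ≤ K z ∧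
      K z ≤ Λ / ‖z.1 - z.2‖ ^ ((n : ℝ) + s z * p z)

lemma gagliardoModular_congr_ae {n : ℕ} (s p : Rn n × Rn n → ℝ) (Ω : Set (Rn n))
    {u v : Rn n → ℝ} (huv : u =ᵐ[volume] v) :
    gagliardoModular s p Ω u = gagliardoModular s p Ω v := by
  refine lintegral_congr_ae (ae_restrict_of_ae ?_)
  filter_upwards [Measure.quasiMeasurePreserving_fst.ae huv,
    Measure.quasiMeasurePreserving_snd.ae huv] with z h1 h2
  rw [h1, h2]

namespace KernelBounds

variable {n : ℕ} {s p K : Rn n × Rn n → ℝ} {σ pm pP Λ : ℝ}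

lemma one_lt_p (h : KernelBounds s p K σ pm pP Λ) (z) : 1 < p z := h.one_lt.trans_le (h.le_p z)

lemma p_pos (h : KernelBounds s p K σ pm pP Λ) (z) : 0 < p z := one_pos.trans (h.one_lt_p z)

lemma pP_pos (h : KernelBounds s p K σ pm pP Λ) : 0 < pP := (h.p_pos 0).trans_le (h.p_le 0)

lemma exponent_nonneg (h : KernelBounds s p K σ pm pP Λ) (z) : 0 ≤ (n : ℝ) + s z * p z := by
  have := h.p_pos z
  have := h.σ_pos.trans_le (h.le_s z)
  positivity

lemma exponent_le (h : KernelBounds s p K σ pm pP Λ) (z) : (n : ℝ) + s z * p z ≤ n + pP := by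
  have := h.p_pos z
  have h1 := h.p_le z
  have h2 := h.s_le z
  nlinarith

lemma le_exponent (h : KernelBounds s p K σ pm pP Λ) (z) :
    (n : ℝ) + σ * pm ≤ (n : ℝ) + s z * p z := by
  have := mul_le_mul (h.le_s z) (h.le_p z) (by linarith [h.one_lt]) (h.σ_pos.le.trans (h.le_s z))
  linarith

lemma K_nonneg (h : KernelBounds s p K σ pm pP Λ) : ∀ᵐ z : Rn n × Rn n, 0 ≤ K z := by
  filter_upwards [h.bounds] with z hz
  have := h.Λ_pos
  exact le_trans (by positivity) hz.1

lemma aemeasurable_fst {v : Rn n → ℝ} (hv : AEMeasurable v volume) :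
    AEMeasurable (fun z : Rn n × Rn n => v z.1) volume :=
  hv.comp_quasiMeasurePreserving Measure.quasiMeasurePreserving_fst

lemma aemeasurable_snd {v : Rn n → ℝ} (hv : AEMeasurable v volume) :
    AEMeasurable (fun z : Rn n × Rn n => v z.2) volume :=
  hv.comp_quasiMeasurePreserving Measure.quasiMeasurePreserving_snd

lemma aemeasurable_diff_rpow (h : KernelBounds s p K σ pm pP Λ) {v : Rn n → ℝ}
    (hv : AEMeasurable v volume) :
    AEMeasurable (fun z : Rn n × Rn n => |v z.1 - v z.2| ^ p z) volume :=
  (((aemeasurable_fst hv).sub (aemeasurable_snd hv)).abs).pow h.p_meas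

lemma aemeasurable_energy_integrand (h : KernelBounds s p K σ pm pP Λ) {v : Rn n → ℝ}
    (hv : AEMeasurable v volume) :
    AEMeasurable (fun z : Rn n × Rn n =>
      ENNReal.ofReal (1 / p z * |v z.1 - v z.2| ^ p z * K z)) volume :=
  (((h.p_meas.const_div 1).mul (h.aemeasurable_diff_rpow hv)).mul h.K_meas).ennreal_ofReal

lemma aemeasurable_modular_integrand (h : KernelBounds s p K σ pm pP Λ) {v : Rn n → ℝ}
    (hv : AEMeasurable v volume) :
    AEMeasurable (fun z : Rn n × Rn n => ENNReal.ofReal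
      (|v z.1 - v z.2| ^ p z / ‖z.1 - z.2‖ ^ ((n : ℝ) + s z * p z))) volume := by
  have h1 : AEMeasurable (fun z : Rn n × Rn n => ‖z.1 - z.2‖) volume := by fun_prop
  exact ((h.aemeasurable_diff_rpow hv).div
    (h1.pow ((h.s_meas.mul h.p_meas).const_add (n : ℝ)))).ennreal_ofReal

/-- Together with `energy_le_modular`, this makes finiteness of the energy and of the modular
equivalent. -/
lemma modular_le_energy (h : KernelBounds s p K σ pm pP Λ) (Ω : Set (Rn n)) (v : Rn n → ℝ) :
    gagliardoModular s p Ω v ≤ ENNReal.ofReal (pP * Λ) * energy p K Ω v := by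
  rw [gagliardoModular, energy, ← lintegral_const_mul' _ _ ENNReal.ofReal_ne_top]
  refine lintegral_mono_ae (ae_restrict_of_ae ?_)
  filter_upwards [h.bounds] with z hz
  have hΛ := h.Λ_pos
  have hp := h.p_pos z
  have hpP := h.pP_pos
  rw [← ENNReal.ofReal_mul (by positivity)]
  refine ENNReal.ofReal_le_ofReal ?_
  set a := |v z.1 - v z.2| ^ p z
  have ha : 0 ≤ a := by positivity
  set d := ‖z.1 - z.2‖ ^ ((n : ℝ) + s z * p z)
  have hd : 0 ≤ d := by positivity
  calc a / d = Λ * a * (Λ⁻¹ / d) := by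
        field_simp
    _ ≤ Λ * a * K z := by
        gcongr
        exact hz.1
    _ = 1 * (Λ * a * K z) := by ring
    _ ≤ (pP / p z) * (Λ * a * K z) := by
        have hK : 0 ≤ K z := le_trans (by positivity) hz.1
        gcongr
        rw [one_le_div hp]
        exact h.p_le z
    _ = _ := by ring

lemma energy_le_modular (h : KernelBounds s p K σ pm pP Λ) (Ω : Set (Rn n)) (v : Rn n → ℝ) :
    energy p K Ω v ≤ ENNReal.ofReal Λ * gagliardoModular s p Ω v := by
  rw [gagliardoModular, energy, ← lintegral_const_mul' _ _ ENNReal.ofReal_ne_top]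
  refine lintegral_mono_ae (ae_restrict_of_ae ?_)
  filter_upwards [h.bounds] with z hz
  have hΛ := h.Λ_pos
  have hp := h.p_pos z
  rw [← ENNReal.ofReal_mul (by positivity)]
  refine ENNReal.ofReal_le_ofReal ?_
  have hK : 0 ≤ K z := le_trans (by positivity) hz.1
  set a := |v z.1 - v z.2| ^ p z
  have ha : 0 ≤ a := by positivity
  have h1 : 1 / p z ≤ 1 := by
    rw [div_le_one hp]
    exact (h.one_lt_p z).le
  calc 1 / p z * a * K z ≤ 1 * a * K z := by gcongr
    _ ≤ 1 * a * (Λ / ‖z.1 - z.2‖ ^ ((n : ℝ) + s z * p z)) := by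
        gcongr
        exact hz.2
    _ = _ := by ring

/-- Uniform convexity of the energy. -/
lemma exists_energy_sub_add_le (h : KernelBounds s p K σ pm pP Λ) {ε : ℝ} (hε : 0 < ε) :
    ∃ C : ℝ≥0, ∀ (Ω : Set (Rn n)) (u w : Rn n → ℝ),
      AEMeasurable u volume → AEMeasurable w volume →
      energy p K Ω (u - w) + C * energy p K Ω (fun x => (u x + w x) / 2)
        ≤ (ENNReal.ofReal ε + C / 2) * (energy p K Ω u + energy p K Ω w) := by
  obtain ⟨C, hC, hconv⟩ := exists_uniform_convexity_rpow (pP := pP) h.one_lt hε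
  refine ⟨C.toNNReal, fun Ω u w hu hw => ?_⟩
  have hcoef : (ENNReal.ofReal ε + (C.toNNReal : ℝ≥0∞) / 2) = ENNReal.ofReal (ε + C / 2) := by
    rw [ENNReal.ofReal_add hε.le (by positivity), ENNReal.ofReal_div_of_pos two_pos]
    simp [ENNReal.ofReal]
  have hcC : (C.toNNReal : ℝ≥0∞) = ENNReal.ofReal C := rfl
  rw [hcoef, hcC]
  simp only [energy]
  rw [← lintegral_const_mul' _ _ ENNReal.ofReal_ne_top,
    ← lintegral_add_left' (h.aemeasurable_energy_integrand (hu.sub hw)).restrict,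
    ← lintegral_add_left' (h.aemeasurable_energy_integrand hu).restrict,
    ← lintegral_const_mul' _ _ ENNReal.ofReal_ne_top]
  refine lintegral_mono_ae (ae_restrict_of_ae ?_)
  filter_upwards [h.K_nonneg] with z hK
  have hp := h.p_pos z
  rw [← ENNReal.ofReal_mul hC, ← ENNReal.ofReal_add (by positivity) (by positivity),
    ← ENNReal.ofReal_add (by positivity) (by positivity), ← ENNReal.ofReal_mul (by positivity)]
  refine ENNReal.ofReal_le_ofReal ?_
  have key := hconv (p z) ⟨h.le_p z, h.p_le z⟩ (u z.1 - u z.2) (w z.1 - w z.2)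
  have e1 : (u - w) z.1 - (u - w) z.2 = u z.1 - u z.2 - (w z.1 - w z.2) := by
    simp only [Pi.sub_apply]; ring
  have e2 : (u z.1 + w z.1) / 2 - (u z.2 + w z.2) / 2
      = (u z.1 - u z.2 + (w z.1 - w z.2)) / 2 := by ring
  rw [e1, e2]
  have := mul_le_mul_of_nonneg_left key (show 0 ≤ 1 / p z * K z by positivity)
  linarith

lemma energy_midpoint_le (h : KernelBounds s p K σ pm pP Λ) (Ω : Set (Rn n)) {u w : Rn n → ℝ}
    (hu : AEMeasurable u volume) :
    energy p K Ω (fun x => (u x + w x) / 2) ≤ energy p K Ω u + energy p K Ω w := by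
  simp only [energy]
  rw [← lintegral_add_left' (h.aemeasurable_energy_integrand hu).restrict]
  refine lintegral_mono_ae (ae_restrict_of_ae ?_)
  filter_upwards [h.K_nonneg] with z hK
  have hp := h.p_pos z
  rw [← ENNReal.ofReal_add (by positivity) (by positivity)]
  refine ENNReal.ofReal_le_ofReal ?_
  have key := abs_midpoint_rpow_le (h.one_lt_p z) (u z.1 - u z.2) (w z.1 - w z.2)
  have e2 : (u z.1 + w z.1) / 2 - (u z.2 + w z.2) / 2
      = (u z.1 - u z.2 + (w z.1 - w z.2)) / 2 := by ring
  rw [e2]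
  have h1 := mul_le_mul_of_nonneg_left key (show 0 ≤ 1 / p z * K z by positivity)
  have h2 : 0 ≤ 1 / p z * K z * (|u z.1 - u z.2| ^ p z + |w z.1 - w z.2| ^ p z) := by positivity
  linarith

lemma prod_subset_crossSet_left {Ω A : Set (Rn n)} : Ω ×ˢ A ⊆ crossSet Ω := by
  rintro z hz h
  exact h.1 hz.1

/-- A function with finite modular is `L^q` on the bounded set `Ω`, `q = inf_{Ω × Ω} p`. -/
lemma memLp_of_modular_lt_top (h : KernelBounds s p K σ pm pP Λ) {Ω : Set (Rn n)}
    (hΩ : IsOpen Ω) (hb : Bornology.IsBounded Ω) {v : Rn n → ℝ} (hv : AEMeasurable v volume)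
    (hfin : gagliardoModular s p Ω v < ∞) :
    MemLp v (ENNReal.ofReal (infOn p Ω)) (volume.restrict Ω) := by
  -- For empty Ω the infimum takes the default value 0, so q > 1 needs a point of Ω.
  rcases Ω.eq_empty_or_nonempty with rfl | hne
  · rw [Measure.restrict_empty]
    exact MemLp.of_bound (hv.mono_ac (Measure.AbsolutelyContinuous.zero _)).aestronglyMeasurable 0
      (by simp)
  have hbelow : BddBelow (p '' (Ω ×ˢ Ω)) := ⟨pm, by rintro _ ⟨z, -, rfl⟩; exact h.le_p z⟩
  set q := infOn p Ω with hq
  have hqp : ∀ z ∈ Ω ×ˢ Ω, q ≤ p z := fun z hz => csInf_le hbelow ⟨z, hz, rfl⟩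
  have hq1 : 1 < q := h.one_lt.trans_le
    (le_csInf ((hne.prod hne).image p) (by rintro _ ⟨z, -, rfl⟩; exact h.le_p z))
  have hvol : volume Ω < ∞ := hb.measure_lt_top
  have : IsFiniteMeasure (volume.restrict Ω) := ⟨by simpa using hvol⟩
  have hvolpos : volume Ω ≠ 0 := (hΩ.measure_pos _ hne).ne'
  obtain ⟨R, hR1, hR⟩ : ∃ R : ℝ, 1 ≤ R ∧ ∀ x ∈ Ω, ∀ y ∈ Ω, ‖x - y‖ ≤ R := by
    obtain ⟨R, hR⟩ := Metric.isBounded_iff.1 hb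
    exact ⟨max 1 R, le_max_left _ _, fun x hx y hy =>
      (dist_eq_norm x y ▸ hR hx hy).trans (le_max_right _ _)⟩
  -- Differences below 1 are absorbed by the constant 1; for larger ones raising the exponent from q
  -- to p(z) only helps, and the denominator is at most R^(n+pP).
  have hpoint : ∀ z ∈ Ω ×ˢ Ω, ENNReal.ofReal (|v z.1 - v z.2| ^ q) ≤
      1 + ENNReal.ofReal (R ^ ((n : ℝ) + pP)) * ENNReal.ofReal
        (|v z.1 - v z.2| ^ p z / ‖z.1 - z.2‖ ^ ((n : ℝ) + s z * p z)) := by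
    intro z hz
    rw [← ENNReal.ofReal_mul (by positivity), ← ENNReal.ofReal_one,
      ← ENNReal.ofReal_add zero_le_one (by positivity)]
    refine ENNReal.ofReal_le_ofReal ?_
    rcases le_total (|v z.1 - v z.2|) 1 with h1 | h1
    · have : |v z.1 - v z.2| ^ q ≤ 1 := Real.rpow_le_one (abs_nonneg _) h1 (by linarith)
      have h2 : 0 ≤ R ^ ((n : ℝ) + pP) *
        (|v z.1 - v z.2| ^ p z / ‖z.1 - z.2‖ ^ ((n : ℝ) + s z * p z)) := by positivity
      linarith
    · have h2 : |v z.1 - v z.2| ^ q ≤ |v z.1 - v z.2| ^ p z :=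
        Real.rpow_le_rpow_of_exponent_le h1 (hqp z hz)
      have hne' : 0 < ‖z.1 - z.2‖ := by
        rw [norm_pos_iff, sub_ne_zero]
        intro he
        rw [he, sub_self, abs_zero] at h1
        linarith
      have hd : 0 < ‖z.1 - z.2‖ ^ ((n : ℝ) + s z * p z) := Real.rpow_pos_of_pos hne' _
      have h3 : ‖z.1 - z.2‖ ^ ((n : ℝ) + s z * p z) ≤ R ^ ((n : ℝ) + pP) :=
        (Real.rpow_le_rpow hne'.le (hR _ hz.1 _ hz.2) (h.exponent_nonneg z)).trans
          (Real.rpow_le_rpow_of_exponent_le hR1 (h.exponent_le z))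
      have h4 : |v z.1 - v z.2| ^ p z ≤ R ^ ((n : ℝ) + pP) *
          (|v z.1 - v z.2| ^ p z / ‖z.1 - z.2‖ ^ ((n : ℝ) + s z * p z)) := by
        rw [mul_div_assoc', le_div_iff₀ hd, mul_comm]
        gcongr
      linarith
  have hdouble : ∫⁻ z in Ω ×ˢ Ω, ENNReal.ofReal (|v z.1 - v z.2| ^ q) < ∞ := by
    calc ∫⁻ z in Ω ×ˢ Ω, ENNReal.ofReal (|v z.1 - v z.2| ^ q)
        ≤ ∫⁻ z in Ω ×ˢ Ω, (1 + ENNReal.ofReal (R ^ ((n : ℝ) + pP)) * ENNReal.ofReal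
          (|v z.1 - v z.2| ^ p z / ‖z.1 - z.2‖ ^ ((n : ℝ) + s z * p z))) :=
          setLIntegral_mono' (hΩ.measurableSet.prod hΩ.measurableSet) hpoint
      _ = volume Ω * volume Ω + ENNReal.ofReal (R ^ ((n : ℝ) + pP)) * ∫⁻ z in Ω ×ˢ Ω,
          ENNReal.ofReal (|v z.1 - v z.2| ^ p z / ‖z.1 - z.2‖ ^ ((n : ℝ) + s z * p z)) := by
          rw [lintegral_add_left measurable_const, lintegral_const_mul' _ _ ENNReal.ofReal_ne_top]
          simp [Measure.volume_eq_prod, Measure.prod_prod]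
      _ ≤ volume Ω * volume Ω +
            ENNReal.ofReal (R ^ ((n : ℝ) + pP)) * gagliardoModular s p Ω v := by
          gcongr
          exact lintegral_mono_set prod_subset_crossSet_left
      _ < ∞ := by
          refine ENNReal.add_lt_top.2 ⟨ENNReal.mul_lt_top hvol hvol,
            ENNReal.mul_lt_top ENNReal.ofReal_lt_top hfin⟩
  have hmeas : AEMeasurable (fun z : Rn n × Rn n => ENNReal.ofReal (|v z.1 - v z.2| ^ q))
      ((volume.restrict Ω).prod (volume.restrict Ω)) := by
    rw [Measure.prod_restrict, ← Measure.volume_eq_prod]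
    exact ((((aemeasurable_fst hv).sub (aemeasurable_snd hv)).abs).pow_const q).ennreal_ofReal.restrict
  rw [Measure.volume_eq_prod, ← Measure.prod_restrict, lintegral_prod_symm _ hmeas] at hdouble
  have hae := ae_lt_top' hmeas.lintegral_prod_left' hdouble.ne
  have hneBot : (ae (volume.restrict Ω)).NeBot := by
    rw [ae_neBot]
    simpa [Measure.restrict_eq_zero] using hvolpos
  -- One slice suffices: v differs from v - v(y) by a constant, which is in L^q since Ω has finite
  -- measure.
  obtain ⟨y, hy⟩ := hae.exists
  have hdiff : MemLp (fun x => v x - v y) (ENNReal.ofReal q) (volume.restrict Ω) := by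
    refine ⟨(hv.restrict.sub_const _).aestronglyMeasurable, ?_⟩
    rw [eLpNorm_lt_top_iff_lintegral_rpow_enorm_lt_top
      (by simpa using (by linarith : 0 < q)) ENNReal.ofReal_ne_top,
      ENNReal.toReal_ofReal (by linarith)]
    convert hy using 3 with x
    rw [← ENNReal.ofReal_rpow_of_nonneg (abs_nonneg _) (by linarith), ← Real.norm_eq_abs,
      ofReal_norm]
  have hadd := hdiff.add (memLp_const (v y))
  convert hadd using 1
  ext x
  simp

/-- Finite energy alone decides membership, which keeps midpoints and limits of competitors
admissible. -/
lemma memW_of_energy_lt_top (h : KernelBounds s p K σ pm pP Λ) {Ω : Set (Rn n)}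
    (hΩ : IsOpen Ω) (hb : Bornology.IsBounded Ω) {v : Rn n → ℝ} (hv : AEMeasurable v volume)
    (hfin : energy p K Ω v < ∞) : MemW s p Ω v := by
  have hm : gagliardoModular s p Ω v < ∞ :=
    (h.modular_le_energy Ω v).trans_lt (ENNReal.mul_lt_top ENNReal.ofReal_lt_top hfin)
  exact ⟨hv, h.memLp_of_modular_lt_top hΩ hb hv hm, hm⟩

lemma energy_lt_top (h : KernelBounds s p K σ pm pP Λ) {Ω : Set (Rn n)} {v : Rn n → ℝ}
    (hv : MemW s p Ω v) : energy p K Ω v < ∞ :=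
  (h.energy_le_modular Ω v).trans_lt (ENNReal.mul_lt_top ENNReal.ofReal_lt_top hv.modular_lt_top)

end KernelBounds
-- Existence and uniqueness of the minimizer
open Filter Topology

namespace KernelBounds

variable {n : ℕ} {s p K : Rn n × Rn n → ℝ} {σ pm pP Λ : ℝ}

/-- If `u` and `w` almost minimize the energy, and their midpoint does not do better than the
infimum, then the energy of `u - w` is small. -/
lemma exists_energy_sub_le (h : KernelBounds s p K σ pm pP Λ) (I : ℝ≥0) {η : ℝ≥0} (hη : 0 < η) :
    ∃ τ : ℝ≥0, 0 < τ ∧ ∀ (Ω : Set (Rn n)) (u w : Rn n → ℝ),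
      AEMeasurable u volume → AEMeasurable w volume →
      (I : ℝ≥0∞) ≤ energy p K Ω (fun x => (u x + w x) / 2) →
      energy p K Ω u ≤ I + τ → energy p K Ω w ≤ I + τ → energy p K Ω (u - w) ≤ η := by
  -- The convexity bound is (ε + C/2)(2I + 2τ) = CI + 2εI + (2ε + C)τ. The choices of ε and τ make
  -- each of the last two terms at most η/2, and the finite CI cancels.
  set ε : ℝ≥0 := η / (4 * (I + 1)) with hεdef
  have hε : 0 < ε := by positivity
  obtain ⟨C, hC⟩ := h.exists_energy_sub_add_le (ε := (ε : ℝ)) (by exact_mod_cast hε)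
  set τ : ℝ≥0 := η / (2 * (2 * ε + C)) with hτdef
  refine ⟨τ, by positivity, fun Ω u w hu hw hmid hEu hEw => ?_⟩
  have h1 := hC Ω u w hu hw
  rw [ENNReal.ofReal_coe_nnreal] at h1
  have h2 : energy p K Ω (u - w) + C * I ≤ η + C * I := by
    calc energy p K Ω (u - w) + C * I
        ≤ energy p K Ω (u - w) + C * energy p K Ω (fun x => (u x + w x) / 2) := by gcongr
      _ ≤ _ := h1
      _ ≤ (ε + C / 2) * ((I + τ) + (I + τ)) := by gcongr
      _ = (((ε + C / 2) * ((I + τ) + (I + τ)) : ℝ≥0) : ℝ≥0∞) := by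
          push_cast
          rfl
      _ ≤ ((η + C * I : ℝ≥0) : ℝ≥0∞) := by
          rw [ENNReal.coe_le_coe, ← NNReal.coe_le_coe]
          push_cast
          have e1 : (ε : ℝ) * (4 * (I + 1)) = η := by
            rw [hεdef]; push_cast; field_simp
          have e2 : (τ : ℝ) * (2 * (2 * ε + C)) = η := by
            have : (0 : ℝ) < 2 * ε + C := by positivity
            rw [hτdef]; push_cast; field_simp
          have : (0 : ℝ) < ε := by exact_mod_cast hε
          nlinarith
      _ = η + C * I := by push_cast; rfl
  exact (ENNReal.add_le_add_iff_right (by finiteness)).1 h2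

/-- A weak Poincaré inequality for functions vanishing outside a bounded set. -/
lemma exists_lintegral_enorm_le (h : KernelBounds s p K σ pm pP Λ) (hn : 1 ≤ n) {Ω : Set (Rn n)}
    (hΩ : IsOpen Ω) (hb : Bornology.IsBounded Ω) {ε : ℝ} (hε : 0 < ε) (hε1 : ε ≤ 1) :
    ∃ C : ℝ≥0, ∀ w : Rn n → ℝ, AEMeasurable w volume → (∀ᵐ x, x ∈ Ωᶜ → w x = 0) →
      ∫⁻ x in Ω, ‖w x‖ₑ ≤ ENNReal.ofReal ε * volume Ω + C * energy p K Ω w := by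
  obtain ⟨R, hR0, hR⟩ : ∃ R : ℝ, 0 < R ∧ ∀ x ∈ Ω, ‖x‖ < R := by
    obtain ⟨R, hR⟩ := hb.exists_norm_le
    exact ⟨max R 0 + 1, by positivity, fun x hx =>
      ((hR x hx).trans (le_max_left R 0)).trans_lt (lt_add_one _)⟩
  -- The unit ball A about c misses Ω, so w = 0 a.e. on A and |w(x) - w(y)| = |w(x)| for a.e. y in
  -- A.
  set c : Rn n := EuclideanSpace.single ⟨0, hn⟩ (R + 1)
  have hc : ‖c‖ = R + 1 := by
    rw [show ‖c‖ = ‖R + 1‖ from PiLp.norm_single _ _ _ _, Real.norm_eq_abs]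
    exact abs_of_pos (by linarith)
  set A := Metric.ball c 1 with hA
  have hAlow : ∀ y ∈ A, R < ‖y‖ ∧ ‖y‖ < R + 2 := by
    intro y hy
    rw [hA, mem_ball_iff_norm] at hy
    have h1 := norm_sub_norm_le c y
    have h2 := norm_sub_norm_le y c
    rw [norm_sub_rev] at h1
    constructor <;> linarith
  have hAΩ : ∀ y ∈ A, y ∈ Ωᶜ := fun y hy hy' => (hR y hy').not_gt (hAlow y hy).1
  have hA0 : volume A ≠ 0 := (Metric.measure_ball_pos _ _ one_pos).ne'
  have hAt : volume A ≠ ∞ := measure_ball_lt_top.ne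
  have hpP := h.pP_pos
  have hΛ := h.Λ_pos
  -- For a ≥ ε one has a ≤ ε^(1-pP) a^p(z), since ε ≤ 1; the other factor bounds the reciprocal of
  -- K(z)/p(z) on Ω × A.
  set M : ℝ := ε ^ (1 - pP) * (pP * Λ * (2 * R + 2) ^ ((n : ℝ) + pP)) with hM
  have hM0 : 0 ≤ M := by positivity
  refine ⟨M.toNNReal / (volume A).toNNReal, fun w hw hw0 => ?_⟩
  have hpoint : ∀ᵐ z ∂(volume.restrict (Ω ×ˢ A)), ‖w z.1‖ₑ ≤ ENNReal.ofReal ε +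
      ENNReal.ofReal M * ENNReal.ofReal (1 / p z * |w z.1 - w z.2| ^ p z * K z) := by
    rw [ae_restrict_iff' (hΩ.measurableSet.prod Metric.isOpen_ball.measurableSet)]
    filter_upwards [h.bounds, Measure.quasiMeasurePreserving_snd.ae hw0] with z hz hz0 hzm
    rw [hz0 (hAΩ _ hzm.2), sub_zero, ← ENNReal.ofReal_mul hM0]
    have hp := h.p_pos z
    have hK0 : 0 ≤ K z := le_trans (by positivity) hz.1
    rw [← ENNReal.ofReal_add hε.le (by positivity), ← ofReal_norm, Real.norm_eq_abs]
    refine ENNReal.ofReal_le_ofReal ?_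
    set a := |w z.1| with ha
    have ha0 : 0 ≤ a := abs_nonneg _
    rcases le_total a ε with hle | hle
    · have : 0 ≤ M * (1 / p z * a ^ p z * K z) := by positivity
      linarith
    · have hdpos : 0 < ‖z.1 - z.2‖ := by
        rw [norm_pos_iff, sub_ne_zero]
        intro he
        exact hAΩ _ hzm.2 (he ▸ hzm.1)
      have hdle : ‖z.1 - z.2‖ ≤ 2 * R + 2 := by
        have := norm_sub_le z.1 z.2
        have h1 := hR _ hzm.1
        have h2 := (hAlow _ hzm.2).2
        linarith
      set d := ‖z.1 - z.2‖ ^ ((n : ℝ) + s z * p z) with hd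
      have hd0 : 0 < d := Real.rpow_pos_of_pos hdpos _
      have hd1 : d ≤ (2 * R + 2) ^ ((n : ℝ) + pP) :=
        (Real.rpow_le_rpow hdpos.le hdle (h.exponent_nonneg z)).trans
          (Real.rpow_le_rpow_of_exponent_le (by linarith) (h.exponent_le z))
      have ha' : 0 < a := hε.trans_le hle
      have h1 : a ≤ ε ^ (1 - pP) * a ^ p z := by
        have e1 : a = a ^ (1 - p z) * a ^ p z := by
          rw [← Real.rpow_add ha']; simp
        have e2 : a ^ (1 - p z) ≤ ε ^ (1 - p z) :=
          Real.rpow_le_rpow_of_nonpos hε hle (by linarith [h.one_lt_p z])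
        have e3 : ε ^ (1 - p z) ≤ ε ^ (1 - pP) :=
          Real.rpow_le_rpow_of_exponent_ge hε hε1 (by linarith [h.p_le z])
        calc a = a ^ (1 - p z) * a ^ p z := e1
          _ ≤ _ := by gcongr; exact e2.trans e3
      have h2 : 1 ≤ pP * Λ * (2 * R + 2) ^ ((n : ℝ) + pP) * (1 / p z * K z) := by
        calc (1 : ℝ) = p z * Λ * d * (1 / p z * (Λ⁻¹ / d)) := by field_simp
          _ ≤ pP * Λ * (2 * R + 2) ^ ((n : ℝ) + pP) * (1 / p z * K z) := by
              gcongr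
              · exact h.p_le z
              · exact hz.1
      calc a ≤ ε ^ (1 - pP) * a ^ p z * 1 := by linarith
        _ ≤ ε ^ (1 - pP) * a ^ p z *
            (pP * Λ * (2 * R + 2) ^ ((n : ℝ) + pP) * (1 / p z * K z)) := by gcongr
        _ = M * (1 / p z * a ^ p z * K z) := by rw [hM]; ring
        _ ≤ _ := by linarith
  have hint : (∫⁻ x in Ω, ‖w x‖ₑ) * volume A ≤
      ENNReal.ofReal ε * volume Ω * volume A + ENNReal.ofReal M * energy p K Ω w := by
    calc (∫⁻ x in Ω, ‖w x‖ₑ) * volume A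
        = ∫⁻ z in Ω ×ˢ A, ‖w z.1‖ₑ := by
          rw [Measure.volume_eq_prod, ← Measure.prod_restrict, lintegral_prod]
          · simp only [lintegral_const, Measure.restrict_apply MeasurableSet.univ, Set.univ_inter]
            rw [lintegral_mul_const' _ _ hAt]
          · rw [Measure.prod_restrict, ← Measure.volume_eq_prod]
            exact (aemeasurable_fst hw).enorm.restrict
      _ ≤ ∫⁻ z in Ω ×ˢ A, (ENNReal.ofReal ε + ENNReal.ofReal M *
            ENNReal.ofReal (1 / p z * |w z.1 - w z.2| ^ p z * K z)) := lintegral_mono_ae hpoint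
      _ = ENNReal.ofReal ε * volume Ω * volume A + ENNReal.ofReal M * ∫⁻ z in Ω ×ˢ A,
            ENNReal.ofReal (1 / p z * |w z.1 - w z.2| ^ p z * K z) := by
          rw [lintegral_add_left measurable_const, lintegral_const_mul' _ _ ENNReal.ofReal_ne_top]
          simp [Measure.volume_eq_prod, Measure.prod_prod, mul_assoc]
      _ ≤ _ := by
          gcongr
          exact lintegral_mono_set prod_subset_crossSet_left
  rw [← ENNReal.le_div_iff_mul_le (Or.inl hA0) (Or.inl hAt), ENNReal.add_div,
    ENNReal.mul_div_cancel_right hA0 hAt] at hint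
  refine hint.trans (le_of_eq ?_)
  rw [ENNReal.coe_div (by simp [ENNReal.toNNReal_eq_zero_iff, hA0, hAt]),
    ENNReal.coe_toNNReal hAt, ENNReal.mul_div_right_comm]
  rfl

/-- The Cauchy estimate behind both existence and uniqueness: almost minimizers with the same
exterior data are close in L¹(Ω). -/
lemma exists_lintegral_enorm_sub_le (h : KernelBounds s p K σ pm pP Λ) (hn : 1 ≤ n)
    {Ω : Set (Rn n)} (hΩ : IsOpen Ω) (hb : Bornology.IsBounded Ω) (I : ℝ≥0) {η : ℝ≥0}
    (hη : 0 < η) :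
    ∃ τ : ℝ≥0, 0 < τ ∧ ∀ (u w : Rn n → ℝ),
      AEMeasurable u volume → AEMeasurable w volume → u =ᵐ[volume.restrict Ωᶜ] w →
      (I : ℝ≥0∞) ≤ energy p K Ω (fun x => (u x + w x) / 2) →
      energy p K Ω u ≤ I + τ → energy p K Ω w ≤ I + τ → ∫⁻ x in Ω, ‖(u - w) x‖ₑ ≤ η := by
  have hvol : volume Ω ≠ ∞ := hb.measure_lt_top.ne
  set V := (volume Ω).toNNReal with hV
  have hVc : volume Ω = V := (ENNReal.coe_toNNReal hvol).symm
  set ε : ℝ≥0 := min 1 (η / (2 * (V + 1))) with hεdef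
  have hε : 0 < ε := by positivity
  obtain ⟨C, hC⟩ := h.exists_lintegral_enorm_le hn hΩ hb (ε := (ε : ℝ)) (by exact_mod_cast hε)
    (by exact_mod_cast min_le_left _ _)
  obtain ⟨τ, hτ, hEτ⟩ := h.exists_energy_sub_le I (η := η / (2 * (C + 1))) (by positivity)
  refine ⟨τ, hτ, fun u w hu hw huw hmid hEu hEw => ?_⟩
  have h0 : ∀ᵐ x, x ∈ Ωᶜ → (u - w) x = 0 := by
    rw [← ae_restrict_iff' hΩ.measurableSet.compl]
    filter_upwards [huw] with x hx
    simp [hx]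
  refine (hC _ (hu.sub hw) h0).trans ?_
  have h1 := hEτ Ω u w hu hw hmid hEu hEw
  rw [hVc, ENNReal.ofReal_coe_nnreal]
  calc (ε : ℝ≥0∞) * V + C * energy p K Ω (u - w)
      ≤ ε * V + C * ((η / (2 * (C + 1)) : ℝ≥0) : ℝ≥0∞) := by gcongr
    _ = ((ε * V + C * (η / (2 * (C + 1))) : ℝ≥0) : ℝ≥0∞) := by push_cast; rfl
    _ ≤ η := by
        rw [ENNReal.coe_le_coe]
        have e1 : ε * V ≤ η / 2 := by
          calc ε * V ≤ η / (2 * (V + 1)) * (V + 1) := by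
                gcongr
                · exact min_le_right _ _
                · simp
            _ = η / 2 := by field_simp
        have e2 : C * (η / (2 * (C + 1))) ≤ η / 2 := by
          calc C * (η / (2 * (C + 1))) ≤ (C + 1) * (η / (2 * (C + 1))) := by
                gcongr
                simp
            _ = η / 2 := by field_simp
        calc _ ≤ η / 2 + η / 2 := add_le_add e1 e2
          _ = η := add_halves η

lemma midpoint_memW (h : KernelBounds s p K σ pm pP Λ) {Ω : Set (Rn n)}
    (hΩ : IsOpen Ω) (hb : Bornology.IsBounded Ω) {u w : Rn n → ℝ} (hu : MemW s p Ω u)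
    (hw : MemW s p Ω w) : MemW s p Ω (fun x => (u x + w x) / 2) :=
  h.memW_of_energy_lt_top hΩ hb ((hu.aemeasurable.add hw.aemeasurable).div_const 2)
    ((h.energy_midpoint_le Ω hu.aemeasurable).trans_lt
      (ENNReal.add_lt_top.2 ⟨h.energy_lt_top hu, h.energy_lt_top hw⟩))

lemma ae_eq_of_isMinimizer (h : KernelBounds s p K σ pm pP Λ) (hn : 1 ≤ n) {Ω : Set (Rn n)}
    (hΩ : IsOpen Ω) (hb : Bornology.IsBounded Ω) {u w : Rn n → ℝ} (hu : IsMinimizer s p K Ω u)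
    (hw : IsMinimizer s p K Ω w) (huw : u =ᵐ[volume.restrict Ωᶜ] w) : u =ᵐ[volume] w := by
  have hE : energy p K Ω w ≤ energy p K Ω u := hw.2 u hu.1 huw.symm
  have hfin := h.energy_lt_top hu.1
  have hmid : energy p K Ω u ≤ energy p K Ω (fun x => (u x + w x) / 2) := by
    refine hu.2 _ (h.midpoint_memW hΩ hb hu.1 hw.1) ?_
    filter_upwards [huw] with x hx
    rw [← hx]
    ring
  have hzero : ∫⁻ x in Ω, ‖(u - w) x‖ₑ = 0 := by
    refine le_antisymm (ENNReal.le_of_forall_pos_le_add fun η hη _ => ?_) bot_le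
    obtain ⟨τ, -, hτ⟩ := h.exists_lintegral_enorm_sub_le hn hΩ hb (energy p K Ω u).toNNReal hη
    rw [ENNReal.coe_toNNReal hfin.ne] at hτ
    simpa using hτ u w hu.1.aemeasurable hw.1.aemeasurable huw hmid le_self_add
      (hE.trans le_self_add)
  rw [lintegral_eq_zero_iff' (hu.1.aemeasurable.sub hw.1.aemeasurable).enorm.restrict] at hzero
  have hin : ∀ᵐ x ∂(volume.restrict Ω), u x = w x := by
    filter_upwards [hzero] with x hx
    simpa [sub_eq_zero] using hx
  have := (ae_restrict_iff' hΩ.measurableSet).1 hin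
  have h2 := (ae_restrict_iff' hΩ.measurableSet.compl).1 huw
  filter_upwards [this, h2] with x h1 h2
  by_cases hx : x ∈ Ω
  · exact h1 hx
  · exact h2 hx

/-- Lower semicontinuity of the energy under a.e. convergence. -/
lemma energy_le_liminf (h : KernelBounds s p K σ pm pP Λ) (Ω : Set (Rn n)) {f : ℕ → Rn n → ℝ}
    {u : Rn n → ℝ} (hf : ∀ k, AEMeasurable (f k) volume)
    (hlim : ∀ᵐ x, Tendsto (fun k => f k x) atTop (𝓝 (u x))) :
    energy p K Ω u ≤ liminf (fun k => energy p K Ω (f k)) atTop := by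
  refine le_trans (le_of_eq ?_)
    (lintegral_liminf_le' fun k => (h.aemeasurable_energy_integrand (hf k)).restrict)
  refine lintegral_congr_ae (ae_restrict_of_ae ?_)
  filter_upwards [Measure.quasiMeasurePreserving_fst.ae hlim,
    Measure.quasiMeasurePreserving_snd.ae hlim] with z h1 h2
  refine (Tendsto.liminf_eq ?_).symm
  refine ENNReal.tendsto_ofReal ?_
  exact (((h1.sub h2).abs.rpow_const (Or.inr (h.p_pos z).le)).const_mul _).mul_const _

lemma exists_isMinimizer (h : KernelBounds s p K σ pm pP Λ) (hn : 1 ≤ n) {Ω : Set (Rn n)}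
    (hΩ : IsOpen Ω) (hb : Bornology.IsBounded Ω) {g : Rn n → ℝ} (hg : MemW s p Ω g) :
    ∃ u, IsMinimizer s p K Ω u ∧ u =ᵐ[volume.restrict Ωᶜ] g := by
  set S : Set ℝ≥0∞ := energy p K Ω '' {v | MemW s p Ω v ∧ v =ᵐ[volume.restrict Ωᶜ] g} with hS
  have hSg : energy p K Ω g ∈ S := ⟨g, ⟨hg, ae_eq_rfl⟩, rfl⟩
  obtain ⟨e, -, hlim, hmem⟩ := exists_seq_tendsto_sInf ⟨_, hSg⟩ (OrderBot.bddBelow S)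
  choose f hf hfe using hmem
  have hI : sInf S < ∞ := (sInf_le hSg).trans_lt (h.energy_lt_top hg)
  set I := (sInf S).toNNReal
  have hIc : (I : ℝ≥0∞) = sInf S := ENNReal.coe_toNNReal hI.ne
  -- The exponent k + 1 leaves room for the strict bound by (1/2)^k in the summable Cauchy
  -- criterion.
  have hpos : ∀ k : ℕ, (0 : ℝ≥0) < (1 / 2) ^ (k + 1) := fun k => by positivity
  choose τ hτ hτf using fun k => h.exists_lintegral_enorm_sub_le hn hΩ hb I (hpos k)
  -- From index φ k on, all energies are within τ k of the infimum.
  obtain ⟨φ, hφ, hφe⟩ := extraction_forall_of_eventually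
    (P := fun k m => ∀ j ≥ m, e j ≤ I + τ k) (fun k => by
      have hlt : sInf S < I + τ k := by
        rw [← hIc]
        exact ENNReal.lt_add_right ENNReal.coe_ne_top (by exact_mod_cast (hτ k).ne')
      obtain ⟨N, hN⟩ := eventually_atTop.1 (hlim.eventually (gt_mem_nhds hlt))
      filter_upwards [eventually_ge_atTop N] with m hm j hj
      exact (hN j (hm.trans hj)).le)
  have hmid : ∀ i j, (I : ℝ≥0∞) ≤ energy p K Ω (fun x => (f i x + f j x) / 2) := by
    intro i j
    rw [hIc]
    refine sInf_le ⟨_, ⟨h.midpoint_memW hΩ hb (hf i).1 (hf j).1, ?_⟩, rfl⟩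
    filter_upwards [(hf i).2, (hf j).2] with x h1 h2
    rw [h1, h2]
    ring
  have hcau : ∀ᵐ x ∂(volume.restrict Ω), ∃ l : ℝ, Tendsto (fun k => f (φ k) x) atTop (𝓝 l) := by
    refine Lp.ae_tendsto_of_cauchy_eLpNorm (p := 1) (B := fun k => (1 / 2 : ℝ≥0∞) ^ k)
      (fun k => (hf (φ k)).1.aemeasurable.restrict.aestronglyMeasurable) le_rfl ?_ ?_
    · rw [ENNReal.tsum_geometric]
      simp
    · intro N i j hi hj
      rw [eLpNorm_one_eq_lintegral_enorm]
      refine (hτf N (f (φ i)) (f (φ j)) (hf _).1.aemeasurable (hf _).1.aemeasurable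
        ((hf _).2.trans (hf _).2.symm) (hmid _ _) ?_ ?_).trans_lt ?_
      · rw [hfe]
        exact hφe N _ (hφ.monotone hi)
      · rw [hfe]
        exact hφe N _ (hφ.monotone hj)
      · have : ((1 / 2 : ℝ≥0) ^ (N + 1)) < (1 / 2 : ℝ≥0) ^ N :=
          pow_lt_pow_right_of_lt_one₀ (by norm_num)
            (by rw [one_div]; exact two_inv_lt_one) (Nat.lt_succ_self N)
        have h2 := ENNReal.coe_lt_coe.2 this
        push_cast at h2 ⊢
        simpa using h2
  have hout : ∀ᵐ x, x ∈ Ωᶜ → ∀ k, f (φ k) x = g x := by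
    rw [← ae_restrict_iff' hΩ.measurableSet.compl, ae_all_iff]
    exact fun k => (hf (φ k)).2
  have hconv : ∀ᵐ x, ∃ l : ℝ, Tendsto (fun k => f (φ k) x) atTop (𝓝 l) := by
    filter_upwards [(ae_restrict_iff' hΩ.measurableSet).1 hcau, hout] with x h1 h2
    by_cases hx : x ∈ Ω
    · exact h1 hx
    · refine ⟨g x, ?_⟩
      simp only [h2 hx]
      exact tendsto_const_nhds
  obtain ⟨u, hum, hu⟩ := measurable_limit_of_tendsto_metrizable_ae
    (fun k => (hf (φ k)).1.aemeasurable) hconv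
  have hug : u =ᵐ[volume.restrict Ωᶜ] g := by
    rw [EventuallyEq, ae_restrict_iff' hΩ.measurableSet.compl]
    filter_upwards [hu, hout] with x h1 h2 hx
    simp only [h2 hx] at h1
    exact tendsto_nhds_unique h1 tendsto_const_nhds
  have hEu : energy p K Ω u ≤ sInf S := by
    refine (h.energy_le_liminf Ω (fun k => (hf (φ k)).1.aemeasurable) hu).trans (le_of_eq ?_)
    refine Tendsto.liminf_eq ?_
    simp only [hfe]
    exact hlim.comp hφ.tendsto_atTop
  refine ⟨u, ⟨h.memW_of_energy_lt_top hΩ hb hum.aemeasurable (hEu.trans_lt hI), ?_⟩, hug⟩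
  intro v hv huv
  exact hEu.trans (sInf_le ⟨v, ⟨hv, huv.symm.trans hug⟩, rfl⟩)

end KernelBounds

/-! ### Measure density of Lipschitz domains -/

/-- A bounded open set with Lipschitz boundary satisfies a uniform interior corkscrew condition. -/
lemma HasLipschitzBoundary.exists_ball_subset {n : ℕ} {Ω : Set (Rn n)}
    (hlip : HasLipschitzBoundary Ω) (hΩ : IsOpen Ω) (hb : Bornology.IsBounded Ω) :
    ∃ c > 0, ∃ r > 0, ∀ x ∈ Ω, ∀ ρ, 0 < ρ → ρ ≤ r →
      ∃ z, Metric.ball z (c * ρ) ⊆ Ω ∩ Metric.ball x ρ := by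
  -- Passing to the compact closure allows local constants to be patched by taking minima.
  suffices h : ∃ c > 0, ∃ r > 0, ∀ x ∈ Ω ∩ closure Ω, ∀ ρ, 0 < ρ → ρ ≤ r →
      ∃ z, Metric.ball z (c * ρ) ⊆ Ω ∩ Metric.ball x ρ by
    obtain ⟨c, hc, r, hr, h⟩ := h
    exact ⟨c, hc, r, hr, fun x hx => h x ⟨hx, subset_closure hx⟩⟩
  refine IsCompact.induction_on (p := fun S => ∃ c > 0, ∃ r > 0, ∀ x ∈ Ω ∩ S, ∀ ρ, 0 < ρ →
    ρ ≤ r → ∃ z, Metric.ball z (c * ρ) ⊆ Ω ∩ Metric.ball x ρ) hb.isCompact_closure ?_ ?_ ?_ ?_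
  · exact ⟨1, one_pos, 1, one_pos, by simp⟩
  · rintro S T hST ⟨c, hc, r, hr, h⟩
    exact ⟨c, hc, r, hr, fun x hx => h x ⟨hx.1, hST hx.2⟩⟩
  · rintro S T ⟨c, hc, r, hr, h⟩ ⟨c', hc', r', hr', h'⟩
    refine ⟨min c c', lt_min hc hc', min r r', lt_min hr hr', ?_⟩
    rintro x ⟨hx, hS | hT⟩ ρ hρ hle
    · obtain ⟨z, hz⟩ := h x ⟨hx, hS⟩ ρ hρ (hle.trans (min_le_left _ _))
      exact ⟨z, (Metric.ball_subset_ball (by gcongr; exact min_le_left _ _)).trans hz⟩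
    · obtain ⟨z, hz⟩ := h' x ⟨hx, hT⟩ ρ hρ (hle.trans (min_le_right _ _))
      exact ⟨z, (Metric.ball_subset_ball (by gcongr; exact min_le_right _ _)).trans hz⟩
  intro x₀ hx₀
  by_cases hin : x₀ ∈ Ω
  · obtain ⟨r, hr, hball⟩ := Metric.isOpen_iff.1 hΩ x₀ hin
    refine ⟨Metric.ball x₀ (r / 2), mem_nhdsWithin_of_mem_nhds
      (Metric.ball_mem_nhds _ (by positivity)), 1, one_pos, r / 2, by positivity, ?_⟩
    rintro x ⟨-, hx⟩ ρ hρ hle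
    refine ⟨x, ?_⟩
    rw [one_mul]
    refine Set.subset_inter (Set.Subset.trans ?_ hball) subset_rfl
    intro y hy
    rw [Metric.mem_ball] at hx hy ⊢
    linarith [dist_triangle y x x₀]
  · have hfr : x₀ ∈ frontier Ω := by
      rw [frontier, hΩ.interior_eq]
      exact ⟨hx₀, hin⟩
    obtain ⟨r, hr, e, L, γ, hγ, hset⟩ := hlip x₀ hfr
    have hL : (0 : ℝ) ≤ L := L.2
    -- Moving x up by ρ/2 gains height ρ/2 over the graph, while a further displacement w costs at
    -- most (L + 1)‖w‖ < (L + 1)cρ < ρ/2.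
    set c : ℝ := 1 / (2 * (L + 2)) with hc
    have hcL : c * (L + 2) = 1 / 2 := by rw [hc]; field_simp
    have hc0 : 0 < c := by positivity
    refine ⟨Metric.ball x₀ (r / 2), mem_nhdsWithin_of_mem_nhds
      (Metric.ball_mem_nhds _ (by positivity)), c, hc0, r / 2, by positivity, ?_⟩
    rintro x ⟨hxΩ, hx⟩ ρ hρ hle
    have hxγ : γ (e x).fst < (e x).snd := by
      have : x ∈ Ω ∩ Metric.ball x₀ r :=
        ⟨hxΩ, Metric.ball_subset_ball (by linarith) hx⟩
      rw [hset] at this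
      exact this.2
    set a : Rn n := e.symm (WithLp.toLp 2 ((0 : Rn (n - 1)), ρ / 2)) with ha
    have hea : e a = WithLp.toLp 2 ((0 : Rn (n - 1)), ρ / 2) := by simp [ha]
    have hna : ‖a‖ = ρ / 2 := by
      rw [ha, LinearIsometryEquiv.norm_map, WithLp.prod_norm_eq_of_L2]
      simp [abs_of_pos hρ, Real.sqrt_sq (show 0 ≤ ρ / 2 by positivity)]
    refine ⟨x + a, fun y hy => ?_⟩
    set w := y - (x + a) with hw
    have hwn : ‖w‖ < c * ρ := by rwa [Metric.mem_ball, dist_eq_norm] at hy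
    have hy_eq : y = x + a + w := by rw [hw]; abel
    have hcρ : c * ρ ≤ ρ / 4 := by nlinarith
    have hyx : dist y x < ρ := by
      rw [dist_eq_norm, hy_eq, show x + a + w - x = a + w by abel]
      calc ‖a + w‖ ≤ ‖a‖ + ‖w‖ := norm_add_le _ _
        _ < ρ := by linarith
    have hy0 : y ∈ Metric.ball x₀ r := by
      rw [Metric.mem_ball] at hx ⊢
      linarith [dist_triangle y x x₀]
    refine ⟨?_, hyx⟩
    suffices hmem : y ∈ Ω ∩ Metric.ball x₀ r from hmem.1
    rw [hset]
    refine ⟨hy0, ?_⟩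
    have hfst : (e y).fst = (e x).fst + (e w).fst := by
      rw [hy_eq, map_add, map_add, hea]
      simp
    have hsnd : (e y).snd = (e x).snd + ρ / 2 + (e w).snd := by
      rw [hy_eq, map_add, map_add, hea]
      simp
    have hnew : ‖e w‖ = ‖w‖ := e.norm_map w
    have h1 : ‖(e w).fst‖ ≤ ‖w‖ := hnew ▸ WithLp.norm_fst_le _ (e w)
    have h2 : ‖(e w).snd‖ ≤ ‖w‖ := hnew ▸ WithLp.norm_snd_le _ (e w)
    have h3 : γ (e y).fst - γ (e x).fst ≤ L * ‖w‖ := by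
      have := hγ.dist_le_mul (e y).fst (e x).fst
      rw [Real.dist_eq, dist_eq_norm, hfst, add_sub_cancel_left] at this
      rw [hfst]
      refine (le_abs_self _).trans (this.trans (by gcongr))
    rw [hsnd]
    have h4 := (abs_le.1 h2).1
    have h5 : ‖w‖ * (L + 1) < ρ / 2 := by nlinarith
    linarith

lemma HasLipschitzBoundary.exists_volume_density {n : ℕ} {Ω : Set (Rn n)}
    (hlip : HasLipschitzBoundary Ω) (hΩ : IsOpen Ω) (hb : Bornology.IsBounded Ω) :
    ∃ κ > 0, ∃ r > 0, ∀ x ∈ Ω, ∀ ρ, 0 < ρ → ρ ≤ r →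
      ENNReal.ofReal (κ * ρ ^ n) ≤ volume (Ω ∩ Metric.ball x ρ) := by
  obtain ⟨c, hc, r, hr, h⟩ := hlip.exists_ball_subset hΩ hb
  have hball : volume (Metric.ball (0 : Rn n) 1) ≠ ∞ := measure_ball_lt_top.ne
  have hpos : 0 < (volume (Metric.ball (0 : Rn n) 1)).toReal :=
    ENNReal.toReal_pos (Metric.measure_ball_pos _ _ one_pos).ne' hball
  refine ⟨c ^ n * (volume (Metric.ball (0 : Rn n) 1)).toReal, by positivity, r, hr, ?_⟩
  intro x hx ρ hρ hle
  obtain ⟨z, hz⟩ := h x hx ρ hρ hle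
  refine le_trans (le_of_eq ?_) (measure_mono hz)
  rw [Measure.addHaar_ball_of_pos volume z (by positivity), finrank_euclideanSpace_fin]
  nth_rewrite 2 [← ENNReal.ofReal_toReal hball]
  rw [← ENNReal.ofReal_mul (by positivity)]
  congr 1
  ring

/-! ### From level-set recursion to integrability -/

/-- Iteration of a decay estimate `m (2t) ≲ t^{-a} m(t)^θ`. -/
lemma exists_decay_of_doubling {m : ℝ → ℝ} {a θ V C t₀ : ℝ} (hm0 : ∀ t, 0 ≤ m t)
    (hmV : ∀ t, m t ≤ V) (hθ : 0 ≤ θ) (hC : 0 ≤ C)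
    (hstep : ∀ t ≥ t₀, m (2 * t) ≤ C * t ^ (-a) * m t ^ θ) (j : ℕ) :
    ∃ D ≥ 0, ∃ T ≥ 1, ∀ t ≥ T, m t ≤ D * t ^ (-(a * ∑ i ∈ Finset.range j, θ ^ i)) := by
  induction j with
  | zero => exact ⟨V, (hm0 0).trans (hmV 0), 1, le_rfl, fun t _ => by simpa using hmV t⟩
  | succ j ih =>
    obtain ⟨D, hD, T, hT, h⟩ := ih
    set q := a * ∑ i ∈ Finset.range j, θ ^ i with hq
    have hq' : a * ∑ i ∈ Finset.range (j + 1), θ ^ i = a + q * θ := by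
      rw [geom_sum_succ, hq]
      ring
    rw [hq']
    -- The recursion is used at t/2, which doubles the threshold and produces the power of 1/2.
    refine ⟨C * D ^ θ * (1 / 2) ^ (-(a + q * θ)), by positivity, 2 * max T t₀, ?_, ?_⟩
    · have := le_max_left T t₀
      linarith
    · intro t ht
      have h1 : T ≤ t / 2 := by linarith [le_max_left T t₀]
      have h2 : t₀ ≤ t / 2 := by linarith [le_max_right T t₀]
      have ht0 : 0 < t / 2 := by linarith
      calc m t = m (2 * (t / 2)) := by ring_nf
        _ ≤ C * (t / 2) ^ (-a) * m (t / 2) ^ θ := hstep _ h2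
        _ ≤ C * (t / 2) ^ (-a) * (D * (t / 2) ^ (-q)) ^ θ := by
            gcongr
            · exact hm0 _
            · exact h _ h1
        _ = C * D ^ θ * ((t / 2) ^ (-a) * (t / 2) ^ (-q * θ)) := by
            rw [Real.mul_rpow hD (by positivity), ← Real.rpow_mul ht0.le]
            ring
        _ = C * D ^ θ * (t / 2) ^ (-(a + q * θ)) := by
            rw [← Real.rpow_add ht0]
            congr 2
            ring
        _ = _ := by
            rw [show t / 2 = 1 / 2 * t by ring, Real.mul_rpow (by norm_num) (by linarith)]
            ring

lemma exists_lt_geom_sum {a θ b : ℝ} (ha : 1 < a) (hθ : 0 ≤ θ)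
    (hb : (θ < 1 ∧ b < a / (1 - θ)) ∨ 1 ≤ θ) :
    ∃ j : ℕ, b < a * ∑ i ∈ Finset.range j, θ ^ i := by
  rcases hb with ⟨h1, h2⟩ | h1
  · have := ((hasSum_geometric_of_lt_one hθ h1).tendsto_sum_nat).const_mul a
    exact (this.eventually (lt_mem_nhds (by rwa [← div_eq_mul_inv]))).exists
  · obtain ⟨j, hj⟩ := exists_nat_gt (max b 0)
    refine ⟨j, ?_⟩
    have hs : (j : ℝ) ≤ ∑ i ∈ Finset.range j, θ ^ i := by
      calc (j : ℝ) = ∑ i ∈ Finset.range j, 1 := by simp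
        _ ≤ _ := Finset.sum_le_sum fun i _ => one_le_pow₀ h1
    have := le_max_left b 0
    have := le_max_right b 0
    nlinarith

/-- Layer cake: a power of the distribution function decaying fast enough gives integrability. -/
lemma lintegral_rpow_lt_top_of_decay {α : Type*} [MeasurableSpace α] {μ : Measure α}
    [IsFiniteMeasure μ] {f : α → ℝ} (hf : AEMeasurable f μ) (hf0 : ∀ x, 0 ≤ f x) {m q D T : ℝ}
    (hm : 0 < m) (hmq : m < q) (hT : 1 ≤ T)
    (hdecay : ∀ t ≥ T, μ.real {x | t < f x} ≤ D * t ^ (-q)) :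
    ∫⁻ x, ENNReal.ofReal (f x ^ m) ∂μ < ∞ := by
  rw [lintegral_rpow_eq_lintegral_meas_lt_mul μ (Eventually.of_forall hf0) hf hm]
  refine ENNReal.mul_lt_top ENNReal.ofReal_lt_top ?_
  have hT0 : 0 < T := by linarith
  -- Below T finiteness of μ and m > 0 suffice; above T the integrand is at most D t^(m-1-q), with m
  -- < q.
  rw [← Set.Ioc_union_Ioi_eq_Ioi hT0.le]
  refine (lintegral_union_le _ _ _).trans_lt (ENNReal.add_lt_top.2 ⟨?_, ?_⟩)
  · have hint : IntegrableOn (fun t : ℝ => t ^ (m - 1)) (Set.Ioc 0 T) :=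
      (intervalIntegrable_iff_integrableOn_Ioc_of_le hT0.le).1
        (intervalIntegral.intervalIntegrable_rpow' (by linarith))
    calc ∫⁻ t in Set.Ioc 0 T, μ {a | t < f a} * ENNReal.ofReal (t ^ (m - 1))
        ≤ ∫⁻ t in Set.Ioc 0 T, μ Set.univ * ENNReal.ofReal (t ^ (m - 1)) := by
          gcongr
          exact Set.subset_univ _
      _ = μ Set.univ * ∫⁻ t in Set.Ioc 0 T, ENNReal.ofReal (t ^ (m - 1)) :=
          lintegral_const_mul' _ _ (measure_ne_top _ _)
      _ < ∞ := ENNReal.mul_lt_top (measure_lt_top _ _) hint.lintegral_lt_top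
  · have hint : IntegrableOn (fun t : ℝ => D * t ^ (m - 1 - q)) (Set.Ioi T) :=
      (integrableOn_Ioi_rpow_of_lt (by linarith) hT0).const_mul D
    refine lt_of_le_of_lt ?_ hint.lintegral_lt_top
    refine setLIntegral_mono' measurableSet_Ioi fun t ht => ?_
    have ht : T < t := ht
    have ht0 : 0 < t := hT0.trans ht
    rw [← ENNReal.ofReal_toReal (measure_ne_top μ {a | t < f a}),
      ← ENNReal.ofReal_mul ENNReal.toReal_nonneg]
    refine ENNReal.ofReal_le_ofReal ?_
    calc _ ≤ D * t ^ (-q) * t ^ (m - 1) := by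
          gcongr
          exact hdecay t ht.le
      _ = _ := by
          rw [mul_assoc, ← Real.rpow_add ht0]
          congr 2
          ring

/-! ### Higher integrability and the tail -/

namespace KernelBounds

variable {n : ℕ} {s p K : Rn n × Rn n → ℝ} {σ pm pP Λ : ℝ}

/-- Decay of the level sets of a function with finite modular. -/
lemma exists_levelSet_le (h : KernelBounds s p K σ pm pP Λ) (hn : 1 ≤ n) {Ω : Set (Rn n)}
    (hΩ : IsOpen Ω) (hb : Bornology.IsBounded Ω) (hlip : HasLipschitzBoundary Ω)
    {v : Rn n → ℝ} (hv : Measurable v) (hfin : gagliardoModular s p Ω v < ∞) :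
    ∃ C ≥ 0, ∃ t₀ ≥ 1, ∀ t ≥ t₀,
      (volume.restrict Ω).real {x | 2 * t < |v x|} ≤
        C * t ^ (-pm) * (volume.restrict Ω).real {x | t < |v x|} ^ (σ * pm / n) := by
  obtain ⟨κ, hκ, r₀, hr₀, hdens⟩ := hlip.exists_volume_density hΩ hb
  have hvol : volume Ω < ∞ := hb.measure_lt_top
  have : IsFiniteMeasure (volume.restrict Ω) := ⟨by simpa using hvol⟩
  have hlev : ∀ t : ℝ, MeasurableSet {x | t < |v x|} := fun t =>
    measurableSet_lt measurable_const hv.abs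
  have hn0 : (0 : ℝ) < n := by exact_mod_cast hn
  have hpm := h.one_lt
  have hσ := h.σ_pos
  set ν := volume.restrict Ω with hν
  set m : ℝ → ℝ := fun t => ν.real {x | t < |v x|} with hm
  set M := (gagliardoModular s p Ω v).toReal with hM
  have hM0 : 0 ≤ M := ENNReal.toReal_nonneg
  set r₁ := min r₀ 1 with hr₁
  have hr₁0 : 0 < r₁ := lt_min hr₀ one_pos
  have htend : Tendsto (fun k : ℕ => m k) atTop (𝓝 0) := by
    have h1 : Tendsto (fun k : ℕ => ν {x | (k : ℝ) < |v x|}) atTop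
        (𝓝 (ν (⋂ k : ℕ, {x | (k : ℝ) < |v x|}))) := by
      refine tendsto_measure_iInter_atTop (fun k => (hlev k).nullMeasurableSet) ?_
        ⟨0, measure_ne_top _ _⟩
      intro i j hij x hx
      have : (i : ℝ) ≤ j := by exact_mod_cast hij
      exact lt_of_le_of_lt this hx
    have h2 : (⋂ k : ℕ, {x | (k : ℝ) < |v x|}) = ∅ := by
      ext x
      simp only [Set.mem_iInter, Set.mem_ofPred_eq, Set.mem_empty_iff_false, iff_false, not_forall,
        not_lt]
      exact exists_nat_ge _
    rw [h2, measure_empty] at h1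
    exact (ENNReal.tendsto_toReal ENNReal.zero_ne_top).comp h1
  -- Beyond level k, m(t) is small enough that the radius r below stays at most r₁.
  obtain ⟨k, hk⟩ := (htend.eventually (gt_mem_nhds (show 0 < κ * r₁ ^ n / 2 by positivity))).exists
  have hanti : Antitone m := fun a b hab => measureReal_mono (fun x hx => lt_of_le_of_lt hab hx)
  set θ := σ * pm / n with hθ
  have hθ0 : 0 < θ := by positivity
  refine ⟨2 * M / κ * (2 / κ) ^ θ, by positivity, max 1 k, le_max_left _ _, fun t ht => ?_⟩
  have ht1 : 1 ≤ t := (le_max_left _ _).trans ht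
  have hmt : m t ≤ κ * r₁ ^ n / 2 := (hanti ((le_max_right _ _).trans ht)).trans hk.le
  change m (2 * t) ≤ 2 * M / κ * (2 / κ) ^ θ * t ^ (-pm) * m t ^ θ
  have hm0 : 0 ≤ m t := measureReal_nonneg
  rcases hm0.eq_or_lt with h0 | h0
  · have : m (2 * t) ≤ m t := hanti (by linarith)
    rw [← h0] at this ⊢
    refine this.trans ?_
    positivity
  -- The density bound gives the ball of radius r mass at least 2m(t) in Ω; removing {|v| > t}
  -- leaves at least m(t).
  set r := (2 * m t / κ) ^ (1 / (n : ℝ)) with hr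
  have hr0 : 0 < r := by positivity
  have hrn : κ * r ^ n = 2 * m t := by
    rw [hr, one_div, Real.rpow_inv_natCast_pow (by positivity) (by omega)]
    field_simp
  have hrr : r ≤ r₁ := by
    refine le_of_pow_le_pow_left₀ (by omega : n ≠ 0) hr₁0.le ?_
    have : κ * r ^ n ≤ κ * r₁ ^ n := by linarith
    exact le_of_mul_le_mul_left this hκ
  have hr1 : r ≤ 1 := hrr.trans (min_le_right _ _)
  set B := t ^ pm / r ^ ((n : ℝ) + σ * pm) with hB
  have hB0 : 0 < B := by positivity
  set G : Rn n × Rn n → ℝ≥0∞ := fun z =>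
    ENNReal.ofReal (|v z.1 - v z.2| ^ p z / ‖z.1 - z.2‖ ^ ((n : ℝ) + s z * p z)) with hG
  have hpt : ∀ x ∈ {x | 2 * t < |v x|}, ∀ y ∈ Metric.ball x r \ {x | t < |v x|},
      ENNReal.ofReal B ≤ G (x, y) := by
    rintro x hx y ⟨hyb, hyt⟩
    have hx : 2 * t < |v x| := hx
    have hy : |v y| ≤ t := not_lt.1 hyt
    refine ENNReal.ofReal_le_ofReal ?_
    have hdiff : t ≤ |v x - v y| := by linarith [abs_sub_abs_le_abs_sub (v x) (v y)]
    have hd0 : 0 < ‖x - y‖ := by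
      rw [norm_pos_iff, sub_ne_zero]
      rintro rfl
      linarith
    have hdr : ‖x - y‖ ≤ r := by
      rw [Metric.mem_ball, dist_comm, dist_eq_norm] at hyb
      exact hyb.le
    refine div_le_div₀ (by positivity) ?_ (Real.rpow_pos_of_pos hd0 _) ?_
    · calc t ^ pm ≤ t ^ p (x, y) := Real.rpow_le_rpow_of_exponent_le ht1 (h.le_p _)
        _ ≤ _ := Real.rpow_le_rpow (by linarith) hdiff (h.p_pos _).le
    · calc ‖x - y‖ ^ ((n : ℝ) + s (x, y) * p (x, y))
          ≤ r ^ ((n : ℝ) + s (x, y) * p (x, y)) :=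
            Real.rpow_le_rpow hd0.le hdr (h.exponent_nonneg _)
        _ ≤ _ := Real.rpow_le_rpow_of_exponent_ge hr0 hr1 (h.le_exponent _)
  have hinner : ∀ x ∈ Ω ∩ {x | 2 * t < |v x|},
      ENNReal.ofReal (B * m t) ≤ ∫⁻ y in Ω, G (x, y) := by
    rintro x ⟨hxΩ, hx⟩
    have hvolY : ENNReal.ofReal (m t) ≤ ν (Metric.ball x r \ {x | t < |v x|}) := by
      calc ENNReal.ofReal (m t) = ENNReal.ofReal (κ * r ^ n) - ENNReal.ofReal (m t) := by
            rw [← ENNReal.ofReal_sub _ hm0, hrn]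
            congr 1
            ring
        _ ≤ ν (Metric.ball x r) - ν {x | t < |v x|} := by
            refine tsub_le_tsub ?_ (le_of_eq ?_)
            · rw [hν, Measure.restrict_apply measurableSet_ball, Set.inter_comm]
              exact hdens x hxΩ r hr0 (hrr.trans (min_le_left _ _))
            · exact (ENNReal.ofReal_toReal (measure_ne_top _ _)).symm
        _ ≤ _ := le_measure_sdiff
    calc ENNReal.ofReal (B * m t) = ENNReal.ofReal B * ENNReal.ofReal (m t) :=
          ENNReal.ofReal_mul hB0.le
      _ ≤ ENNReal.ofReal B * ν (Metric.ball x r \ {x | t < |v x|}) := by gcongr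
      _ = ∫⁻ y in Metric.ball x r \ {x | t < |v x|}, ENNReal.ofReal B ∂ν := by
          rw [setLIntegral_const]
      _ ≤ ∫⁻ y in Metric.ball x r \ {x | t < |v x|}, G (x, y) ∂ν :=
          setLIntegral_mono' (measurableSet_ball.diff (hlev t)) (hpt x hx)
      _ ≤ ∫⁻ y in Ω, G (x, y) := setLIntegral_le_lintegral _ _
  have hmain : ENNReal.ofReal (B * m t * m (2 * t)) ≤ gagliardoModular s p Ω v := by
    calc ENNReal.ofReal (B * m t * m (2 * t))
        = ENNReal.ofReal (B * m t) * ν {x | 2 * t < |v x|} := by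
          rw [ENNReal.ofReal_mul (by positivity)]
          congr 1
          exact ENNReal.ofReal_toReal (measure_ne_top _ _)
      _ = ∫⁻ x in {x | 2 * t < |v x|}, ENNReal.ofReal (B * m t) ∂ν := by rw [setLIntegral_const]
      _ ≤ ∫⁻ x in {x | 2 * t < |v x|}, (∫⁻ y in Ω, G (x, y)) ∂ν := by
          rw [hν, Measure.restrict_restrict (hlev _)]
          refine setLIntegral_mono' ((hlev _).inter hΩ.measurableSet) fun x hx => ?_
          exact hinner x ⟨hx.2, hx.1⟩
      _ ≤ ∫⁻ x in Ω, ∫⁻ y in Ω, G (x, y) := setLIntegral_le_lintegral _ _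
      _ = ∫⁻ z in Ω ×ˢ Ω, G z := by
          rw [Measure.volume_eq_prod, ← Measure.prod_restrict, lintegral_prod]
          rw [Measure.prod_restrict, ← Measure.volume_eq_prod]
          exact (h.aemeasurable_modular_integrand hv.aemeasurable).restrict
      _ ≤ gagliardoModular s p Ω v := lintegral_mono_set prod_subset_crossSet_left
  have hreal : B * m t * m (2 * t) ≤ M := (ENNReal.ofReal_le_iff_le_toReal hfin.ne).1 hmain
  have hrσ : r ^ (σ * pm) = (2 / κ) ^ θ * m t ^ θ := by
    rw [hr, ← Real.rpow_mul (by positivity), ← Real.mul_rpow (by positivity) hm0, hθ]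
    congr 1 <;> ring
  -- The factor r^n in B cancels m(t), leaving r^(σ pm), which is a constant times m(t)^θ.
  have hBm : B * m t = t ^ pm * κ / (2 * r ^ (σ * pm)) := by
    have e1 : m t = κ * r ^ n / 2 := by linarith
    rw [hB, Real.rpow_add hr0, Real.rpow_natCast]
    nth_rewrite 1 [e1]
    field_simp
  have hm2 : m (2 * t) ≤ M / (t ^ pm * κ / (2 * r ^ (σ * pm))) := by
    rw [le_div_iff₀ (by positivity), ← hBm]
    linarith
  refine hm2.trans (le_of_eq ?_)
  rw [hrσ, Real.rpow_neg (by linarith)]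
  field_simp

/-- The Sobolev-type integrability gain for functions with finite modular. -/
lemma lintegral_rpow_lt_top (h : KernelBounds s p K σ pm pP Λ) (hn : 1 ≤ n) {Ω : Set (Rn n)}
    (hΩ : IsOpen Ω) (hb : Bornology.IsBounded Ω) (hlip : HasLipschitzBoundary Ω)
    {m : ℝ} (hm : 0 < m)
    (hexp : (σ * pm < n ∧ m < n * pm / (n - σ * pm)) ∨ (n : ℝ) ≤ σ * pm)
    {v : Rn n → ℝ} (hv : AEMeasurable v volume) (hfin : gagliardoModular s p Ω v < ∞) :
    ∫⁻ x in Ω, ENNReal.ofReal (|v x| ^ m) < ∞ := by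
  have hvol : volume Ω < ∞ := hb.measure_lt_top
  have : IsFiniteMeasure (volume.restrict Ω) := ⟨by simpa using hvol⟩
  have hn0 : (0 : ℝ) < n := by exact_mod_cast hn
  have hθ : 0 ≤ σ * pm / n := by
    have := h.σ_pos
    have := h.one_lt
    positivity
  have hcond : (σ * pm / n < 1 ∧ m < pm / (1 - σ * pm / n)) ∨ 1 ≤ σ * pm / n := by
    rcases hexp with ⟨h1, h2⟩ | h1
    · left
      refine ⟨(div_lt_one hn0).2 h1, h2.trans_eq ?_⟩
      have : (n : ℝ) - σ * pm ≠ 0 := by linarith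
      field_simp
    · right
      exact (one_le_div hn0).2 h1
  obtain ⟨j, hj⟩ := exists_lt_geom_sum h.one_lt hθ hcond
  -- The level-set argument runs on a measurable representative.
  rw [gagliardoModular_congr_ae s p Ω hv.ae_eq_mk] at hfin
  obtain ⟨C, hC, t₀, -, hstep⟩ := h.exists_levelSet_le hn hΩ hb hlip hv.measurable_mk hfin
  obtain ⟨D, -, T, hT, hdecay⟩ := exists_decay_of_doubling
    (m := fun t => (volume.restrict Ω).real {x | t < |hv.mk v x|})
    (fun _ => measureReal_nonneg) (fun _ => measureReal_mono (Set.subset_univ _)) hθ hC hstep j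
  have key := lintegral_rpow_lt_top_of_decay (μ := volume.restrict Ω)
    hv.measurable_mk.abs.aemeasurable (fun _ => abs_nonneg _) hm hj hT hdecay
  refine lt_of_le_of_lt (le_of_eq (lintegral_congr_ae (ae_restrict_of_ae ?_))) key
  filter_upwards [hv.ae_eq_mk] with x hx
  rw [← hx]

/-- Inside Ω the weight is at most 1 and |u|^(p-1) ≤ 1 + |u|^(pP-1), a bound independent of x;
outside, the integral is dominated by the tail of g. -/
lemma memTail_of_eq_compl (h : KernelBounds s p K σ pm pP Λ) {Ω : Set (Rn n)}
    (hΩ : IsOpen Ω) (hb : Bornology.IsBounded Ω) {u g : Rn n → ℝ} (hu : AEMeasurable u volume)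
    (hint : ∫⁻ x in Ω, ENNReal.ofReal (|u x| ^ (pP - 1)) < ∞)
    (hug : u =ᵐ[volume.restrict Ωᶜ] g) (hg : MemTail s p Ω g) : MemTail s p Ω u := by
  refine ⟨hu, ?_⟩
  set A := ∫⁻ y in Ω, (1 + ENNReal.ofReal (|u y| ^ (pP - 1)))
  have hA : A < ∞ := by
    simp only [A]
    rw [lintegral_add_left measurable_const]
    refine ENNReal.add_lt_top.2 ⟨?_, hint⟩
    simpa using hb.measure_lt_top
  refine lt_of_le_of_lt (essSup_le_of_ae_le _ ?_) (ENNReal.add_lt_top.2 ⟨hA, hg.essSup_lt_top⟩)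
  filter_upwards [ENNReal.ae_le_essSup (μ := volume.restrict Ω) (fun x => ∫⁻ y, ENNReal.ofReal
      (|g y| ^ (p (x, y) - 1) / (1 + ‖y‖) ^ ((n : ℝ) + s (x, y) * p (x, y))))] with x hx
  rw [← lintegral_add_compl _ hΩ.measurableSet]
  refine add_le_add (lintegral_mono fun y => ?_) (le_trans ?_ hx)
  · rw [← ENNReal.ofReal_one, ← ENNReal.ofReal_add zero_le_one (by positivity)]
    refine ENNReal.ofReal_le_ofReal ?_
    have hden : 1 ≤ (1 + ‖y‖) ^ ((n : ℝ) + s (x, y) * p (x, y)) :=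
      Real.one_le_rpow (by linarith [norm_nonneg y]) (h.exponent_nonneg _)
    refine (div_le_self (by positivity) hden).trans ?_
    have h1 := h.one_lt_p (x, y)
    rcases le_total |u y| 1 with hle | hle
    · have e1 : |u y| ^ (p (x, y) - 1) ≤ 1 := Real.rpow_le_one (abs_nonneg _) hle (by linarith)
      have e2 : 0 ≤ |u y| ^ (pP - 1) := by positivity
      linarith
    · have := Real.rpow_le_rpow_of_exponent_le hle (show p (x, y) - 1 ≤ pP - 1 by
        linarith [h.p_le (x, y)])
      linarith
  · refine le_trans (le_of_eq (lintegral_congr_ae ?_)) (setLIntegral_le_lintegral Ωᶜ _)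
    filter_upwards [hug] with y hy
    rw [hy]

end KernelBounds

/-! ### Proof of the theorem -/

lemma kernelBounds_of_infOn_supOn {n : ℕ} {s p K : Rn n × Rn n → ℝ} {Λ : ℝ}
    (hs_meas : AEMeasurable s volume) (hs_bdd : BddAbove (Set.range s))
    (hs_inf : 0 < infOn s Set.univ) (hs_sup : supOn s Set.univ < 1)
    (hp_meas : AEMeasurable p volume)
    (hp_bdd : BddAbove (Set.range p)) (hp_inf : 1 < infOn p Set.univ)
    (hK_meas : AEMeasurable K volume) (hΛ : 1 < Λ)
    (hK : ∀ᵐ z : Rn n × Rn n,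
      Λ⁻¹ / ‖z.1 - z.2‖ ^ ((n : ℝ) + s z * p z) ≤ K z ∧
      K z ≤ Λ / ‖z.1 - z.2‖ ^ ((n : ℝ) + s z * p z)) :
    KernelBounds s p K (infOn s Set.univ) (infOn p Set.univ) (supOn p Set.univ) Λ := by
  have hle : ∀ f : Rn n × Rn n → ℝ, 0 < infOn f Set.univ → ∀ z, infOn f Set.univ ≤ f z := by
    intro f hf z
    simp only [infOn, Set.univ_prod_univ, Set.image_univ] at hf ⊢
    refine csInf_le ?_ ⟨z, rfl⟩
    -- A set unbounded below has real infimum 0 by convention, so a positive infimum forces a lower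
    -- bound.
    by_contra hnb
    rw [Real.sInf_of_not_bddBelow hnb] at hf
    exact hf.false
  have hge : ∀ f : Rn n × Rn n → ℝ, BddAbove (Set.range f) → ∀ z, f z ≤ supOn f Set.univ := by
    intro f hf z
    simp only [supOn, Set.univ_prod_univ, Set.image_univ]
    exact le_csSup hf ⟨z, rfl⟩
  exact
    { s_meas := hs_meas
      p_meas := hp_meas
      K_meas := hK_meas
      σ_pos := hs_inf
      le_s := hle s hs_inf
      s_le := fun z => (hge s hs_bdd z).trans hs_sup.le
      one_lt := hp_inf
      le_p := hle p (one_pos.trans hp_inf)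
      p_le := hge p hp_bdd
      Λ_pos := one_pos.trans hΛ
      bounds := hK }

theorem theorem3p1 {n : ℕ} (hn : 2 ≤ n)
    (s p K : Rn n × Rn n → ℝ) (Λ : ℝ)
    (hs_meas : AEMeasurable s volume) (hs_symm : IsSymm2 s)
    (hs_bdd : BddAbove (Set.range s))
    (hs_inf : 0 < infOn s Set.univ) (hs_sup : supOn s Set.univ < 1)
    (hp_meas : AEMeasurable p volume) (hp_symm : IsSymm2 p)
    (hp_bdd : BddAbove (Set.range p)) (hp_inf : 1 < infOn p Set.univ)
    (hK_meas : AEMeasurable K volume) (hK_symm : IsSymm2 K) (hΛ : 1 < Λ)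
    (hK : ∀ᵐ z : Rn n × Rn n,
      Λ⁻¹ / ‖z.1 - z.2‖ ^ ((n : ℝ) + s z * p z) ≤ K z ∧
      K z ≤ Λ / ‖z.1 - z.2‖ ^ ((n : ℝ) + s z * p z))
    (Ω : Set (Rn n)) (hΩ_open : IsOpen Ω) (hΩ_bdd : Bornology.IsBounded Ω)
    (hΩ_lip : HasLipschitzBoundary Ω)
    (g : Rn n → ℝ) (hg : MemW s p Ω g) :
    (∃ u : Rn n → ℝ,
      (IsMinimizer s p K Ω u ∧ u =ᵐ[volume.restrict Ωᶜ] g) ∧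
      ∀ w : Rn n → ℝ, IsMinimizer s p K Ω w → w =ᵐ[volume.restrict Ωᶜ] g → w =ᵐ[volume] u) ∧
    (((infOn s Set.univ * infOn p Set.univ < n ∧
        supOn p Set.univ - 1 <
          n * infOn p Set.univ / (n - infOn s Set.univ * infOn p Set.univ)) ∨
        (n : ℝ) ≤ infOn s Set.univ * infOn p Set.univ) →
      MemTail s p Ω g →
      ∀ u : Rn n → ℝ, IsMinimizer s p K Ω u → u =ᵐ[volume.restrict Ωᶜ] g → MemTail s p Ω u) := by
  have h := kernelBounds_of_infOn_supOn hs_meas hs_bdd hs_inf hs_sup hp_meas hp_bdd hp_inf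
    hK_meas hΛ hK
  have hn1 : 1 ≤ n := by omega
  refine ⟨?_, ?_⟩
  · obtain ⟨u, hu, hug⟩ := h.exists_isMinimizer hn1 hΩ_open hΩ_bdd hg
    exact ⟨u, ⟨hu, hug⟩, fun w hw hwg =>
      h.ae_eq_of_isMinimizer hn1 hΩ_open hΩ_bdd hw hu (hwg.trans hug.symm)⟩
  · intro hexp htail u hu hug
    have hm : 0 < supOn p Set.univ - 1 := by linarith [h.one_lt_p 0, h.p_le 0]
    exact h.memTail_of_eq_compl hΩ_open hΩ_bdd hu.1.aemeasurable
      (h.lintegral_rpow_lt_top hn1 hΩ_open hΩ_bdd hΩ_lip hm hexp hu.1.aemeasurable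
        hu.1.modular_lt_top) hug htail
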